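/- Let $m\ge 2$ be an even integer. Let $n\ge 0$, let $A_0,\dots,A_n\in\mathbb R$ with $\sum_{j=0}^n A_j=1$ and $A_0\neq 0$, let $w_0=0$ and $w_j\in\mathbb R\setminus\{0\}$ for $1\le j\le n$, and let $\kappa_0,\dots,\kappa_n\in(0,1)$. Let $\eta(x)$, $x\in\mathbb R$, be a real-valued, (jointly) measurable Gaussian random process with mean $\mathbb E\eta(x)=M(x)$ and covariance function $$\mathrm{Cov}(\eta(y),\eta(y+x))=\sum_{j=0}^n A_j\frac{\cos(w_jx)}{(1+x^2)^{\kappa_j/2}},\qquad x,y\in\mathbb R.$$ Let $$u_m(t,x)=\frac1{2\pi}\int_{\mathbb R}e^{-i\alpha x-\alpha^m t}\,d\alpha$$ be the fundamental solution of $\partial_t u=(-1)^{m/2+1}\partial_x^m u$, and assume that $y\mapsto M(x-y)\,u_m(t,y)$ is integrable on $\mathbb R$ for all $t>0$, $x\in\mathbb R$. Let $$u(t,x)=\int_{\mathbb R}\eta(x-y)\,u_m(t,y)\,dy,\qquad t>0,\ x\in\mathbb R,$$ be the solution with random initial condition $\eta$. Then, as $\varepsilon\to 0^+$, the finite-dimensional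 distributions of the random fields $$U_\varepsilon(t,x)=\varepsilon^{-\kappa_0/4}\left(u\Big(\frac t{\sqrt{\varepsilon^m}},\frac x{\sqrt\varepsilon}\Big)-\mathbb E\,u\Big(\frac t{\sqrt{\varepsilon^m}},\frac x{\sqrt\varepsilon}\Big)\right),\qquad t>0,\ x\in\mathbb R,$$ converge weakly to the finite-dimensional distributions of the real-valued zero-mean Gaussian random field $$U_0(t,x)=\sqrt{A_0\,c_2(\kappa_0)}\int_{\mathbb R}\frac{e^{i\lambda x-\lambda^m t}}{|\lambda|^{(1-\kappa_0)/2}}\,W(d\lambda),\qquad c_2(\kappa)=\frac1{2\Gamma(\kappa)\cos(\kappa\pi/2)},$$ where $W$ is a complex Gaussian white noise random measure on $\mathbb R$ with Lebesgue control measure, symmetric around the origin (that is, $\mathbb E\,W(A)\overline{W(B)}=|A\cap B|$ and $W(-A)=\overline{W(A)}$ for Borel sets $A,B$ of finite length). For all $t,t'>0$ and $x,x'\in\mathbb R$, the covariance function of $U_0$ is $$\mathrm{Cov}(U_0(t,x),U_0(t',x'))=A_0c_2(\kappa_0)\int_{\mathbb R}|\lambda|^{\kappa_0-1}\cos(\lambda(x-x'))\,e^{-(t+t')\lambda^m}\,d\lambda$$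 $$=\frac{2\sqrt\pi\,A_0c_2(\kappa_0)}{m(t+t')^{\kappa_0/m}}\;{}_1\Psi_1\!\left[\begin{array}{c}(\kappa_0/m,\,2/m)\\(1/2,\,1)\end{array};\,-\frac{(x-x')^2}{4(t+t')^{2/m}}\right],$$ where ${}_1\Psi_1\!\left[\begin{array}{c}(a,\alpha)\\(b,\beta)\end{array};z\right]=\sum_{k=0}^\infty\frac{\Gamma(a+\alpha k)}{\Gamma(b+\beta k)}\frac{z^k}{k!}$ is the Fox–Wright function; the integral converges absolutely and the series converges. -/

import Mathlib

open MeasureTheory ProbabilityTheory Filter Topology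

noncomputable section

namespace RandomHeat

/-- The fundamental solution of the heat equation of even order `m`,
`u_m(t, x) = (2π)⁻¹ ∫ e^{-iαx - α^m t} dα`. For even `m` the integral is real. -/
def fundSol (m : ℕ) (t x : ℝ) : ℝ :=
  (1 / (2 * (Real.pi : ℂ)) *
    ∫ α : ℝ, Complex.exp (-Complex.I * (α : ℂ) * (x : ℂ) - (α : ℂ) ^ m * (t : ℂ))).re

/-- The solution with random initial condition `η`, as the (pathwise) convolution of `η` with the
fundamental solution: `u(t, x) = ∫ η(x - y) u_m(t, y) dy`. -/
def solution {Ω : Type*} (m : ℕ) (η : ℝ → Ω → ℝ) (t x : ℝ) (ω : Ω) : ℝ :=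
  ∫ y : ℝ, η (x - y) ω * fundSol m t y

/-- The rescaled centred solution
`U_ε(t, x) = ε^{-κ/4} (u(t / √(ε^m), x / √ε) - E u(t / √(ε^m), x / √ε))`. -/
def rescaledSolution {Ω : Type*} [MeasurableSpace Ω] (P : Measure Ω) (m : ℕ) (κ : ℝ)
    (η : ℝ → Ω → ℝ) (ε t x : ℝ) (ω : Ω) : ℝ :=
  ε ^ (-κ / 4) *
    (solution m η (t / √(ε ^ m)) (x / √ε) ω -
      ∫ ω', solution m η (t / √(ε ^ m)) (x / √ε) ω' ∂P)

/-- The covariance function `r(x) = ∑ j, A_j cos(w_j x) / (1 + x²)^{κ_j / 2}`. -/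
def initialCov {n : ℕ} (A w κ : Fin (n + 1) → ℝ) (x : ℝ) : ℝ :=
  ∑ j, Real.cos (w j * x) / (1 + x ^ 2) ^ (κ j / 2) * A j

/-- The constant `c₂(κ) = (2 Γ(κ) cos(κπ/2))⁻¹`. -/
def c₂ (κ : ℝ) : ℝ := (2 * Real.Gamma κ * Real.cos (κ * Real.pi / 2))⁻¹

/-- The `k`-th term of the Fox–Wright series with numerator parameters `(α_j, A_j) = a j` and
denominator parameters `(β_j, B_j) = b j`. -/
def foxWrightTerm {p q : ℕ} (a : Fin p → ℝ × ℝ) (b : Fin q → ℝ × ℝ) (z : ℝ) (k : ℕ) : ℝ :=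
  (∏ j, Real.Gamma ((a j).1 + (a j).2 * k)) / (∏ j, Real.Gamma ((b j).1 + (b j).2 * k)) *
    (z ^ k / (k.factorial : ℝ))

/-- The Fox–Wright generalized hypergeometric function `ₚΨ_q[a; b; z]`. -/
def foxWright {p q : ℕ} (a : Fin p → ℝ × ℝ) (b : Fin q → ℝ × ℝ) (z : ℝ) : ℝ :=
  ∑' k : ℕ, foxWrightTerm a b z k

/-- `W` is a complex Gaussian white noise random measure on `ℝ` (with Lebesgue control measure),
symmetric around the origin: a centred, additive, jointly Gaussian family of square integrable
complex random variables indexed by the Borel sets of finite length, with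
`E W(A) conj W(B) = |A ∩ B|` and `W(-A) = conj W(A)`. The values of `W` on other sets are
irrelevant. -/
structure IsSymmetricWhiteNoise {Ω : Type*} [MeasurableSpace Ω] (P : Measure Ω)
    (W : Set ℝ → Ω → ℂ) : Prop where
  memLp : ∀ A, MeasurableSet A → volume A < ⊤ → MemLp (W A) 2 P
  gaussian : IsGaussianProcess
    (fun (A : {A : Set ℝ // MeasurableSet A ∧ volume A < ⊤}) ω => W A.1 ω) P
  mean_zero : ∀ A, MeasurableSet A → volume A < ⊤ → ∫ ω, W A ω ∂P = 0
  additive : ∀ A B, MeasurableSet A → volume A < ⊤ → MeasurableSet B → volume B < ⊤ →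
    Disjoint A B → ∀ᵐ ω ∂P, W (A ∪ B) ω = W A ω + W B ω
  covariance : ∀ A B, MeasurableSet A → volume A < ⊤ → MeasurableSet B → volume B < ⊤ →
    ∫ ω, W A ω * (starRingEnd ℂ) (W B ω) ∂P = (volume.real (A ∩ B) : ℂ)
  symmetric : ∀ A, MeasurableSet A → volume A < ⊤ →
    ∀ᵐ ω ∂P, W {x | -x ∈ A} ω = (starRingEnd ℂ) (W A ω)

/-- The stochastic integral of a simple function: `∑ c, c · W({s = c})`. -/
def simpleIntegral {Ω : Type*} (W : Set ℝ → Ω → ℂ) (s : SimpleFunc ℝ ℂ) (ω : Ω) : ℂ :=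
  ∑ c ∈ s.range, c * W (s ⁻¹' {c}) ω

/-- `X` is (a version of) the stochastic integral `∫ h(λ) W(dλ)` of `h ∈ L²(ℝ)`: the limit in
`L²(Ω)` of the integrals of simple functions converging to `h` in `L²(ℝ)`. -/
def HasStochasticIntegral {Ω : Type*} [MeasurableSpace Ω] (P : Measure Ω) (W : Set ℝ → Ω → ℂ)
    (h : ℝ → ℂ) (X : Ω → ℂ) : Prop :=
  MemLp h 2 volume ∧ MemLp X 2 P ∧
    ∃ s : ℕ → SimpleFunc ℝ ℂ, (∀ k, MemLp (s k) 2 volume) ∧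
      Tendsto (fun k => eLpNorm (fun l => h l - s k l) 2 volume) atTop (𝓝 0) ∧
      Tendsto (fun k => eLpNorm (fun ω => X ω - simpleIntegral W (s k) ω) 2 P) atTop (𝓝 0)

/-- The integrand `λ ↦ e^{iλx - λ^m t} / |λ|^{(1-κ)/2}` of the limit field. -/
def limitKernel (m : ℕ) (κ t x l : ℝ) : ℂ :=
  Complex.exp (Complex.I * (l : ℂ) * (x : ℂ) - (l : ℂ) ^ m * (t : ℂ)) /
    ((|l| ^ ((1 - κ) / 2) : ℝ) : ℂ)

end RandomHeat

end

/-! Centred Gaussian vectors converge in law as soon as their covariances do, so everything reduces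
to Gaussianity of both fields and one deterministic limit.

Gaussianity is handled inside L²(Ω). The closed linear span of a centred Gaussian process consists
of centred Gaussian variables (`hasGaussianCharFun_of_mem`), and any finite family taken from it is
jointly Gaussian (`hasGaussianLaw_of_submodule`). The convolution of the centred initial condition
with the fundamental solution lies in such a span (`toLp_integral_mul_mem`), and so do the
stochastic integrals that define the limit (`IsSymmetricWhiteNoise.toLp_re_mem`).

For the covariance, the semigroup property gives E[u(t,x)u(t',x')] = (r * u_m(t+t'))(x-x') for the
centred solution. With T = t+t', x now standing for the difference x-x', and self-similarity of u_m,
the rescaled covariance is the sum over j of A_j ε^{(1-κ₀)/2} ∫ cos(w_j s) (1+s²)^{-κ_j/2} u_m(T,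
x-√ε s) ds. If w_j ≠ 0, an integration by parts bounds the integral uniformly in ε, so the prefactor
kills the term (`exists_abs_integral_cos_mul_le`). The term j = 0 equals A₀ ∫ (ε+s²)^{-κ₀/2} u_m(T,
x-s) ds and tends to a Riesz potential. That limit is computed by writing (ε+s²)^{-κ/2} as a Gamma
mixture of Gaussians in s, whose Fourier transforms are explicit
(`integral_add_sq_rpow_mul_fundSol`); only dominated convergence remains.

The white-noise isometry gives the same covariance for the limit field. Expanding the cosine and
integrating termwise yields the Fox–Wright series (`hasSum_foxWrightTerm`). The sign condition
A₀c₂(κ₀) ≥ 0, needed for the square root, comes from the limit itself: it is a limit of variances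
divided by a positive number. -/

noncomputable section

namespace RandomHeat

open scoped FourierTransform

/-! ### Regularity, semigroup property and scaling of the fundamental solution -/

section FundamentalSolution

variable {m : ℕ} {t : ℝ}

theorem integral_abs_rpow_mul_exp (hm : Even m) (hm0 : 0 < m) (ht : 0 < t) {q : ℝ}
    (hq : -1 < q) : ∫ a : ℝ, |a| ^ q * Real.exp (-t * a ^ m) =
      2 / m * Real.Gamma ((q + 1) / m) * t ^ (-(q + 1) / m) := by
  have h := integral_rpow_mul_exp_neg_mul_rpow (Nat.cast_pos.2 hm0 : (0 : ℝ) < m) hq ht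
  have h2 := integral_comp_abs (f := fun x : ℝ => x ^ q * Real.exp (-t * x ^ (m : ℝ)))
  rw [h] at h2
  simp only [Real.rpow_natCast, hm.pow_abs] at h2
  rw [h2]; ring

theorem integrable_abs_rpow_mul_exp (hm : Even m) (hm0 : 0 < m) (ht : 0 < t) {q : ℝ}
    (hq : -1 < q) : Integrable fun a : ℝ => |a| ^ q * Real.exp (-t * a ^ m) := by
  -- The Bochner integral of a non-integrable function is 0, so a positive value already proves
  -- integrability.
  refine .of_integral_ne_zero (ne_of_gt ?_)
  rw [integral_abs_rpow_mul_exp hm hm0 ht hq]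
  have : (0 : ℝ) < m := Nat.cast_pos.2 hm0
  have := Real.Gamma_pos_of_pos (div_pos (by linarith : 0 < q + 1) this)
  positivity

/-- A polynomial times the symbol of the heat semigroup of order `m`. -/
def polyExp (m : ℕ) (t : ℝ) (p : Polynomial ℝ) (a : ℝ) : ℂ :=
  ((p.eval a * Real.exp (-t * a ^ m) : ℝ) : ℂ)

theorem continuous_polyExp (p : Polynomial ℝ) : Continuous (polyExp m t p) := by
  unfold polyExp
  fun_prop

theorem integrable_polyExp (hm : Even m) (hm0 : 0 < m) (ht : 0 < t) (p : Polynomial ℝ) :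
    Integrable (polyExp m t p) := by
  suffices h : Integrable fun a : ℝ => p.eval a * Real.exp (-t * a ^ m) from h.ofReal
  induction p using Polynomial.induction_on' with
  | add p q hp hq =>
    refine (hp.add hq).congr (Eventually.of_forall fun a => ?_)
    simp [add_mul]
  | monomial n c =>
    have h := (integrable_abs_rpow_mul_exp hm hm0 ht (q := n)
      (by have : (0 : ℝ) ≤ n := n.cast_nonneg
          linarith)).const_mul |c|
    refine h.mono' (by fun_prop) (Eventually.of_forall fun a => ?_)
    simp [mul_assoc]

/-- Polynomials times exp(-t a^m) are stable under differentiation and under multiplication by a.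
This gives decay and differentiability of their Fourier transforms by pure algebra on the
polynomial. -/
theorem hasDerivAt_polyExp (p : Polynomial ℝ) (a : ℝ) :
    HasDerivAt (polyExp m t p)
      (polyExp m t (p.derivative - p * (Polynomial.C (t * m) * Polynomial.X ^ (m - 1))) a) a := by
  refine HasDerivAt.ofReal_comp ?_
  have h := (p.hasDerivAt a).mul (((hasDerivAt_pow m a).const_mul (-t)).exp)
  convert! h using 1
  simp
  ring

theorem fourier_polyExp_deriv (hm : Even m) (hm0 : 0 < m) (ht : 0 < t) (p : Polynomial ℝ) (x : ℝ) :
    𝓕 (polyExp m t (p.derivative - p * (Polynomial.C (t * m) * Polynomial.X ^ (m - 1)))) x =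
      (2 * Real.pi * Complex.I * x) * 𝓕 (polyExp m t p) x := by
  have hd : deriv (polyExp m t p) =
      polyExp m t (p.derivative - p * (Polynomial.C (t * m) * Polynomial.X ^ (m - 1))) :=
    funext fun a => (hasDerivAt_polyExp p a).deriv
  have h := Real.fourier_deriv (integrable_polyExp hm hm0 ht p)
    (fun a => (hasDerivAt_polyExp p a).differentiableAt)
    (by rw [hd]; exact integrable_polyExp hm hm0 ht _)
  rw [hd] at h
  simpa using congrFun h x

theorem norm_fourier_polyExp_le (p : Polynomial ℝ) (x : ℝ) :
    ‖𝓕 (polyExp m t p) x‖ ≤ ∫ a, ‖polyExp m t p a‖ :=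
  VectorFourier.norm_fourierIntegral_le_integral_norm _ _ _ _ _

theorem continuous_fourier_polyExp (hm : Even m) (hm0 : 0 < m) (ht : 0 < t) (p : Polynomial ℝ) :
    Continuous (𝓕 (polyExp m t p)) :=
  VectorFourier.fourierIntegral_continuous Real.continuous_fourierChar
    (by exact continuous_inner) (integrable_polyExp hm hm0 ht p)

/-- Two derivatives before the transform cost a factor (2πx)² after it, which gives domination by a
multiple of (1+x²)⁻¹. -/
theorem integrable_fourier_polyExp (hm : Even m) (hm0 : 0 < m) (ht : 0 < t) (p : Polynomial ℝ) :
    Integrable (𝓕 (polyExp m t p)) := by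
  set D : Polynomial ℝ → Polynomial ℝ :=
    fun p => p.derivative - p * (Polynomial.C (t * m) * Polynomial.X ^ (m - 1)) with hD
  have hbound (x : ℝ) : ‖𝓕 (polyExp m t p) x‖ ≤
      ((∫ a, ‖polyExp m t p a‖) + ∫ a, ‖polyExp m t (D (D p)) a‖) * (1 + x ^ 2)⁻¹ := by
    have h1 := norm_fourier_polyExp_le (m := m) (t := t) p x
    have h2 := norm_fourier_polyExp_le (m := m) (t := t) (D (D p)) x
    rw [fourier_polyExp_deriv hm hm0 ht, fourier_polyExp_deriv hm hm0 ht] at h2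
    rw [← div_eq_mul_inv, le_div_iff₀ (by positivity)]
    have h3 : x ^ 2 * ‖𝓕 (polyExp m t p) x‖ ≤ ∫ a, ‖polyExp m t (D (D p)) a‖ := by
      refine le_trans ?_ h2
      simp only [norm_mul, Complex.norm_I, Complex.norm_real, Real.norm_eq_abs,
        abs_of_pos Real.pi_pos, Complex.norm_ofNat, mul_one]
      have : x ^ 2 = |x| * |x| := by rw [← sq, sq_abs]
      rw [this]
      have hpi : (1 : ℝ) ≤ 2 * Real.pi := by linarith [Real.pi_gt_three]
      have h0 : 0 ≤ |x| * |x| * ‖𝓕 (polyExp m t p) x‖ := by positivity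
      nlinarith [mul_le_mul hpi hpi zero_le_one (by linarith)]
    linarith
  exact (integrable_inv_one_add_sq.const_mul _).mono'
    (continuous_fourier_polyExp hm hm0 ht p).aestronglyMeasurable (Eventually.of_forall hbound)

theorem hasDerivAt_fourier_polyExp (hm : Even m) (hm0 : 0 < m) (ht : 0 < t) (p : Polynomial ℝ)
    (x : ℝ) : HasDerivAt (𝓕 (polyExp m t p))
      ((-2 * Real.pi * Complex.I) * 𝓕 (polyExp m t (Polynomial.X * p)) x) x := by
  have hX : (fun a : ℝ => a • polyExp m t p a) = polyExp m t (Polynomial.X * p) := by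
    funext a
    simp [polyExp]
    ring
  have h := Real.hasDerivAt_fourier (integrable_polyExp hm hm0 ht p)
    (by rw [hX]; exact integrable_polyExp hm hm0 ht _) x
  convert! h using 1
  rw [Real.fourier_real_eq_integral_exp_smul, Real.fourier_real_eq_integral_exp_smul,
    ← integral_const_mul]
  congr 1
  funext a
  rw [← hX]
  simp
  ring

theorem integral_eq_zero_of_odd_fun {f : ℝ → ℝ} (hf : ∀ x, f (-x) = -f x) : ∫ x, f x = 0 := by
  have h := integral_neg_eq_self f volume
  simp only [hf, integral_neg] at h
  linarith

theorem integrable_exp_neg_mul_pow (hm : Even m) (hm0 : 0 < m) (ht : 0 < t) :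
    Integrable fun a : ℝ => Real.exp (-t * a ^ m) := by
  simpa using integrable_abs_rpow_mul_exp hm hm0 ht (q := 0) (by norm_num)

theorem integrable_mul_exp_neg_mul_pow (hm : Even m) (hm0 : 0 < m) (ht : 0 < t) {f : ℝ → ℝ}
    (hf : Continuous f) (hf1 : ∀ x, |f x| ≤ 1) :
    Integrable fun a : ℝ => f a * Real.exp (-t * a ^ m) :=
  (integrable_exp_neg_mul_pow hm hm0 ht).bdd_mul (c := 1) hf.aestronglyMeasurable
    (Eventually.of_forall hf1)

/-- The sine part is odd because m is even; hence the real part taken in `fundSol` loses nothing. -/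
theorem integral_cexp_mul_exp (hm : Even m) (hm0 : 0 < m) (ht : 0 < t) (x : ℝ) :
    ∫ a : ℝ, Complex.exp (-Complex.I * a * x - (a : ℂ) ^ m * t) =
      ((∫ a : ℝ, Real.cos (a * x) * Real.exp (-t * a ^ m) : ℝ) : ℂ) := by
  have hc := integrable_mul_exp_neg_mul_pow hm hm0 ht (f := fun a => Real.cos (a * x))
    (by fun_prop) (fun a => Real.abs_cos_le_one _)
  have hs := integrable_mul_exp_neg_mul_pow hm hm0 ht (f := fun a => Real.sin (a * x))
    (by fun_prop) (fun a => Real.abs_sin_le_one _)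
  have h0 : ∫ a : ℝ, Real.sin (a * x) * Real.exp (-t * a ^ m) = 0 :=
    integral_eq_zero_of_odd_fun fun a => by simp [hm.neg_pow]
  have h1 : (fun a : ℝ => Complex.exp (-Complex.I * a * x - (a : ℂ) ^ m * t)) =
      fun a : ℝ => ((Real.cos (a * x) * Real.exp (-t * a ^ m) : ℝ) : ℂ) -
        Complex.I * ((Real.sin (a * x) * Real.exp (-t * a ^ m) : ℝ) : ℂ) := by
    funext a
    have : -Complex.I * a * x - (a : ℂ) ^ m * t =
        ((-(a * x) : ℝ) : ℂ) * Complex.I + ((-t * a ^ m : ℝ) : ℂ) := by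
      push_cast; ring
    rw [this, Complex.exp_add, Complex.exp_mul_I, ← Complex.ofReal_cos, ← Complex.ofReal_sin,
      ← Complex.ofReal_exp, Real.cos_neg, Real.sin_neg]
    push_cast; ring
  rw [h1, integral_sub hc.ofReal (hs.ofReal.const_mul _), integral_const_mul,
    integral_complex_ofReal, integral_complex_ofReal, h0]
  simp

theorem fundSol_eq (hm : Even m) (hm0 : 0 < m) (ht : 0 < t) (x : ℝ) :
    fundSol m t x =
      (2 * Real.pi)⁻¹ * ∫ a : ℝ, Real.cos (a * x) * Real.exp (-t * a ^ m) := by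
  rw [fundSol, integral_cexp_mul_exp hm hm0 ht]
  rw [← Complex.ofReal_re ((2 * Real.pi)⁻¹ * _)]
  congr 1
  push_cast
  ring

theorem fourier_polyExp_one (hm : Even m) (hm0 : 0 < m) (ht : 0 < t) (x : ℝ) :
    𝓕 (polyExp m t 1) x = ((2 * Real.pi * fundSol m t (2 * Real.pi * x) : ℝ) : ℂ) := by
  rw [fundSol_eq hm hm0 ht, mul_inv_cancel_left₀ (by positivity),
    ← integral_cexp_mul_exp hm hm0 ht, Real.fourier_real_eq_integral_exp_smul]
  congr 1
  funext a
  rw [polyExp, Polynomial.eval_one, one_mul, Complex.ofReal_exp, smul_eq_mul, ← Complex.exp_add]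
  push_cast
  ring_nf

theorem fundSol_eq_fourier (hm : Even m) (hm0 : 0 < m) (ht : 0 < t) (x : ℝ) :
    fundSol m t x = (2 * Real.pi)⁻¹ * (𝓕 (polyExp m t 1) ((2 * Real.pi)⁻¹ * x)).re := by
  rw [fourier_polyExp_one hm hm0 ht, Complex.ofReal_re, mul_inv_cancel_left₀ (by positivity),
    inv_mul_cancel_left₀ (by positivity)]

theorem integrable_comp_two_pi_inv {f : ℝ → ℂ} (hf : Integrable f) :
    Integrable fun x : ℝ => (2 * Real.pi)⁻¹ * (f ((2 * Real.pi)⁻¹ * x)).re :=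
  ((hf.comp_mul_left' (by positivity : (2 * Real.pi)⁻¹ ≠ 0)).re).const_mul _

theorem integrable_fundSol (hm : Even m) (hm0 : 0 < m) (ht : 0 < t) :
    Integrable (fundSol m t) := by
  rw [funext (fundSol_eq_fourier hm hm0 ht)]
  exact integrable_comp_two_pi_inv (integrable_fourier_polyExp hm hm0 ht 1)

theorem exists_hasDerivAt_fundSol (hm : Even m) (hm0 : 0 < m) (ht : 0 < t) :
    ∃ u' : ℝ → ℝ, Integrable u' ∧ ∀ x, HasDerivAt (fundSol m t) (u' x) x := by
  refine ⟨fun x => (2 * Real.pi)⁻¹ * (((2 * Real.pi)⁻¹ : ℝ) * ((-2 * Real.pi * Complex.I) *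
      𝓕 (polyExp m t (Polynomial.X * 1)) ((2 * Real.pi)⁻¹ * x))).re, ?_, fun x => ?_⟩
  · exact integrable_comp_two_pi_inv (f := fun y => (((2 * Real.pi)⁻¹ : ℝ) *
      ((-2 * Real.pi * Complex.I) * 𝓕 (polyExp m t (Polynomial.X * 1)) y)))
      (((integrable_fourier_polyExp hm hm0 ht _).const_mul _).const_mul _)
  · rw [funext (fundSol_eq_fourier hm hm0 ht)]
    have h1 := hasDerivAt_fourier_polyExp hm hm0 ht 1 ((2 * Real.pi)⁻¹ * x)
    have h2 := h1.scomp x ((hasDerivAt_id x).const_mul (2 * Real.pi)⁻¹)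
    have h3 := (Complex.reCLM.hasFDerivAt.comp_hasDerivAt x h2).const_mul (2 * Real.pi)⁻¹
    convert! h3 using 1
    simp

theorem fundSol_neg (hm : Even m) (hm0 : 0 < m) (ht : 0 < t) (x : ℝ) :
    fundSol m t (-x) = fundSol m t x := by
  simp [fundSol_eq hm hm0 ht]

theorem exists_abs_fundSol_le (hm : Even m) (hm0 : 0 < m) (ht : 0 < t) :
    ∃ C, ∀ x, |fundSol m t x| ≤ C := by
  refine ⟨(2 * Real.pi)⁻¹ * ∫ a, ‖polyExp m t 1 a‖, fun x => ?_⟩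
  rw [fundSol_eq_fourier hm hm0 ht, abs_mul, abs_of_pos (by positivity)]
  gcongr
  exact (Complex.abs_re_le_norm _).trans (norm_fourier_polyExp_le _ _)

/-- Fourier inversion for the symbol, followed by the change of variable that removes the 2π from
the exponent. -/
theorem integral_fundSol_mul_cos (hm : Even m) (hm0 : 0 < m) (ht : 0 < t) (a : ℝ) :
    ∫ x, fundSol m t x * Real.cos (a * x) = Real.exp (-t * a ^ m) := by
  have h := congrFun ((continuous_polyExp (m := m) (t := t) 1).fourierInv_fourier_eq
    (integrable_polyExp hm hm0 ht 1) (integrable_fourier_polyExp hm hm0 ht 1)) a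
  rw [Real.fourierInv_eq'] at h
  simp only [fourier_polyExp_one hm hm0 ht] at h
  have hi : Integrable fun v : ℝ => 2 * Real.pi * fundSol m t (2 * Real.pi * v) :=
    ((integrable_fundSol hm hm0 ht).comp_mul_left' (by positivity)).const_mul _
  have h2 := congrArg Complex.re h
  rw [← RCLike.re_eq_complex_re, ← integral_re] at h2
  · simp only [polyExp, Polynomial.eval_one, one_mul, RCLike.re_eq_complex_re, Complex.ofReal_re,
      smul_eq_mul] at h2
    rw [← h2]
    have h3 := Measure.integral_comp_mul_left (fun x => fundSol m t x * Real.cos (a * x))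
      (2 * Real.pi)
    rw [abs_of_pos (by positivity), smul_eq_mul, eq_inv_mul_iff_mul_eq₀ (by positivity),
      ← integral_const_mul] at h3
    rw [← h3]
    congr 1
    funext v
    rw [Complex.re_mul_ofReal, Complex.exp_ofReal_mul_I_re]
    simp only [RCLike.inner_apply, conj_trivial]
    ring_nf
  · refine hi.ofReal.bdd_mul (c := 1) (by fun_prop) (Eventually.of_forall fun v => ?_)
    rw [Complex.norm_exp_ofReal_mul_I]

theorem integral_fundSol_mul_cos_add (hm : Even m) (hm0 : 0 < m) (ht : 0 < t) (a s : ℝ) :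
    ∫ x, fundSol m t x * Real.cos (a * (s + x)) = Real.cos (a * s) * Real.exp (-t * a ^ m) := by
  have hi := integrable_fundSol hm hm0 ht
  have hc : Integrable fun x => fundSol m t x * Real.cos (a * x) :=
    hi.mul_bdd (c := 1) (by fun_prop) (Eventually.of_forall fun a => Real.abs_cos_le_one _)
  have hs : Integrable fun x => fundSol m t x * Real.sin (a * x) :=
    hi.mul_bdd (c := 1) (by fun_prop) (Eventually.of_forall fun a => Real.abs_sin_le_one _)
  have h0 : ∫ x, fundSol m t x * Real.sin (a * x) = 0 :=
    integral_eq_zero_of_odd_fun fun a => by simp [fundSol_neg hm hm0 ht]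
  have h1 : (fun x => fundSol m t x * Real.cos (a * (s + x))) = fun x =>
      Real.cos (a * s) * (fundSol m t x * Real.cos (a * x)) -
        Real.sin (a * s) * (fundSol m t x * Real.sin (a * x)) := by
    funext x
    rw [mul_add, Real.cos_add]; ring
  rw [h1, integral_sub (hc.const_mul _) (hs.const_mul _), integral_const_mul, integral_const_mul,
    h0, integral_fundSol_mul_cos hm hm0 ht]
  ring

/-- The semigroup property of the fundamental solution. -/
theorem integral_fundSol_mul_fundSol (hm : Even m) (hm0 : 0 < m) (ht : 0 < t) {t' : ℝ}
    (ht' : 0 < t') (s : ℝ) :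
    ∫ y, fundSol m t (s + y) * fundSol m t' y = fundSol m (t + t') s := by
  have hE := integrable_exp_neg_mul_pow hm hm0 ht
  have hu := integrable_fundSol hm hm0 ht'
  have hint : Integrable (fun z : ℝ × ℝ =>
      fundSol m t' z.1 * Real.exp (-t * z.2 ^ m) * Real.cos (z.2 * (s + z.1)))
      (volume.prod volume) :=
    (hu.mul_prod hE).mul_bdd (c := 1) (by fun_prop)
      (Eventually.of_forall fun a => Real.abs_cos_le_one _)
  -- Only one factor is expanded in frequencies. Fubini then needs just the product of two
  -- integrable functions, and the y-integral of the other factor supplies the second exponential.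
  have h1 : (fun y => fundSol m t (s + y) * fundSol m t' y) = fun y => (2 * Real.pi)⁻¹ *
      ∫ a, fundSol m t' y * Real.exp (-t * a ^ m) * Real.cos (a * (s + y)) := by
    funext y
    rw [fundSol_eq hm hm0 ht, mul_assoc, mul_comm (∫ a : ℝ, _), ← integral_const_mul]
    congr 2
    funext a
    ring
  rw [h1, integral_const_mul, integral_integral_swap hint, fundSol_eq hm hm0 (by positivity)]
  congr 2
  funext a
  have h2 : (fun y => fundSol m t' y * Real.exp (-t * a ^ m) * Real.cos (a * (s + y))) =
      fun y => Real.exp (-t * a ^ m) * (fundSol m t' y * Real.cos (a * (s + y))) := by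
    funext y; ring
  rw [h2, integral_const_mul, integral_fundSol_mul_cos_add hm hm0 ht',
    show -(t + t') * a ^ m = -t * a ^ m + -t' * a ^ m by ring, Real.exp_add]
  ring

/-- Self-similarity, by the substitution a ↦ d a in frequency. It is applied with d = √ε. -/
theorem fundSol_div_pow (hm : Even m) (hm0 : 0 < m) (ht : 0 < t) {d : ℝ} (hd : 0 < d) (s : ℝ) :
    fundSol m (t / d ^ m) s = d * fundSol m t (d * s) := by
  rw [fundSol_eq hm hm0 (by positivity), fundSol_eq hm hm0 ht]
  have h := Measure.integral_comp_mul_left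
    (fun a => Real.cos (a * s) * Real.exp (-(t / d ^ m) * a ^ m)) d
  rw [abs_of_pos (by positivity), smul_eq_mul, eq_inv_mul_iff_mul_eq₀ hd.ne'] at h
  rw [← h]
  have h2 : (fun x => Real.cos (d * x * s) * Real.exp (-(t / d ^ m) * (d * x) ^ m)) =
      fun a => Real.cos (a * (d * s)) * Real.exp (-t * a ^ m) := by
    funext x
    congr 2
    · ring
    · rw [mul_pow]; field_simp
  rw [h2]; ring

theorem measurable_fundSol (m : ℕ) (t : ℝ) : Measurable (fundSol m t) := by
  unfold fundSol
  refine Complex.measurable_re.comp (Measurable.const_mul ?_ _)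
  refine (StronglyMeasurable.integral_prod_right' (f := fun z : ℝ × ℝ =>
    Complex.exp (-Complex.I * (z.2 : ℂ) * (z.1 : ℂ) - (z.2 : ℂ) ^ m * (t : ℂ))) ?_).measurable
  exact Continuous.stronglyMeasurable (by fun_prop)

end FundamentalSolution


/-! ### The Riesz potential of the fundamental solution, through Gaussian mixtures -/

section RieszPotential

variable {m : ℕ} {T κ : ℝ}

theorem integral_exp_neg_mul_sq_mul_cos {τ : ℝ} (hτ : 0 < τ) (a : ℝ) :
    ∫ s : ℝ, Real.exp (-τ * s ^ 2) * Real.cos (a * s) =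
      √(Real.pi / τ) * Real.exp (-(a ^ 2 / (4 * τ))) := by
  have h := congrArg Complex.re (fourierIntegral_gaussian (b := τ) (by simpa using hτ) a)
  have h1 : ((Real.pi / τ : ℂ) ^ (1 / 2 : ℂ) * Complex.exp (-(a : ℂ) ^ 2 / (4 * (τ : ℂ)))) =
      ((√(Real.pi / τ) * Real.exp (-(a ^ 2 / (4 * τ))) : ℝ) : ℂ) := by
    rw [Real.sqrt_eq_rpow, Complex.ofReal_mul, Complex.ofReal_cpow (by positivity)]
    push_cast
    ring_nf
  have h2 : (fun x : ℝ => Complex.exp (Complex.I * a * x) * Complex.exp (-(τ : ℂ) * (x : ℂ) ^ 2)) =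
      fun x : ℝ => Complex.exp ((a * x : ℝ) * Complex.I) * ((Real.exp (-τ * x ^ 2) : ℝ) : ℂ) := by
    funext x
    push_cast
    ring_nf
  rw [h1, Complex.ofReal_re, h2, ← RCLike.re_eq_complex_re, ← integral_re] at h
  · rw [← h]
    congr 1
    funext x
    rw [RCLike.re_eq_complex_re, Complex.re_mul_ofReal, Complex.exp_ofReal_mul_I_re, mul_comm]
  · refine (integrable_exp_neg_mul_sq hτ).ofReal.bdd_mul (c := 1) (by fun_prop)
      (Eventually.of_forall fun v => ?_)
    rw [Complex.norm_exp_ofReal_mul_I]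

theorem integral_exp_neg_mul_sq_mul_cos_sub {τ : ℝ} (hτ : 0 < τ) (a x : ℝ) :
    ∫ s : ℝ, Real.exp (-τ * s ^ 2) * Real.cos (a * (x - s)) =
      Real.cos (a * x) * (√(Real.pi / τ) * Real.exp (-(a ^ 2 / (4 * τ)))) := by
  have hi := integrable_exp_neg_mul_sq hτ
  have hc : Integrable fun s => Real.exp (-τ * s ^ 2) * Real.cos (a * s) :=
    hi.mul_bdd (c := 1) (by fun_prop) (Eventually.of_forall fun a => Real.abs_cos_le_one _)
  have hs : Integrable fun s => Real.exp (-τ * s ^ 2) * Real.sin (a * s) :=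
    hi.mul_bdd (c := 1) (by fun_prop) (Eventually.of_forall fun a => Real.abs_sin_le_one _)
  have h0 : ∫ s, Real.exp (-τ * s ^ 2) * Real.sin (a * s) = 0 :=
    integral_eq_zero_of_odd_fun fun a => by simp
  have h1 : (fun s => Real.exp (-τ * s ^ 2) * Real.cos (a * (x - s))) = fun s =>
      Real.cos (a * x) * (Real.exp (-τ * s ^ 2) * Real.cos (a * s)) +
        Real.sin (a * x) * (Real.exp (-τ * s ^ 2) * Real.sin (a * s)) := by
    funext s
    rw [mul_sub, Real.cos_sub]; ring
  rw [h1, integral_add (hc.const_mul _) (hs.const_mul _), integral_const_mul, integral_const_mul,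
    h0, integral_exp_neg_mul_sq_mul_cos hτ]
  ring

theorem integral_exp_neg_mul_sq_mul_fundSol (hm : Even m) (hm0 : 0 < m) (hT : 0 < T) {τ : ℝ}
    (hτ : 0 < τ) (x : ℝ) :
    ∫ s : ℝ, Real.exp (-τ * s ^ 2) * fundSol m T (x - s) =
      (2 * Real.pi)⁻¹ * ∫ a : ℝ, Real.exp (-T * a ^ m) *
        (Real.cos (a * x) * (√(Real.pi / τ) * Real.exp (-(a ^ 2 / (4 * τ))))) := by
  have hint : Integrable (fun z : ℝ × ℝ =>
      Real.exp (-τ * z.1 ^ 2) * Real.exp (-T * z.2 ^ m) * Real.cos (z.2 * (x - z.1)))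
      (volume.prod volume) :=
    ((integrable_exp_neg_mul_sq hτ).mul_prod (integrable_exp_neg_mul_pow hm hm0 hT)).mul_bdd
      (c := 1) (by fun_prop) (Eventually.of_forall fun a => Real.abs_cos_le_one _)
  have h1 : (fun s => Real.exp (-τ * s ^ 2) * fundSol m T (x - s)) = fun s => (2 * Real.pi)⁻¹ *
      ∫ a, Real.exp (-τ * s ^ 2) * Real.exp (-T * a ^ m) * Real.cos (a * (x - s)) := by
    funext s
    rw [fundSol_eq hm hm0 hT, mul_left_comm, ← integral_const_mul]
    congr 2
    funext a
    ring
  rw [h1, integral_const_mul, integral_integral_swap hint]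
  congr 2
  funext a
  rw [← integral_exp_neg_mul_sq_mul_cos_sub hτ, ← integral_const_mul]
  congr 1
  funext s
  ring

/-- The inversion σ = 1/τ turns this into a Gamma integral. -/
theorem integral_Ioi_rpow_mul_exp_neg_inv {b c : ℝ} (hb : 0 < b) (hc : 0 < c) :
    ∫ τ in Set.Ioi (0 : ℝ), τ ^ (-b - 1) * Real.exp (-(c / τ)) = (1 / c) ^ b * Real.Gamma b := by
  rw [← Real.integral_rpow_mul_exp_neg_mul_Ioi hb hc,
    ← integral_comp_rpow_Ioi (fun σ => σ ^ (b - 1) * Real.exp (-(c * σ)))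
      (by norm_num : (-1 : ℝ) ≠ 0)]
  refine setIntegral_congr_fun measurableSet_Ioi fun τ hτ => ?_
  have hτ' : 0 < τ := hτ
  simp only [abs_neg, abs_one, one_mul, smul_eq_mul]
  rw [Real.rpow_neg_one, Real.inv_rpow hτ'.le, ← Real.rpow_neg hτ'.le, ← mul_assoc,
    ← Real.rpow_add hτ', div_eq_mul_inv]
  ring_nf

/-- Duplication of Gamma at κ/2 and reflection at (κ+1)/2. The right-hand side is the form of the
constant which the Gaussian mixture produces. -/
theorem c₂_eq (hκ : κ ∈ Set.Ioo (0 : ℝ) 1) :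
    c₂ κ = (2 * √Real.pi * Real.Gamma (κ / 2))⁻¹ * (2 ^ (1 - κ) * Real.Gamma ((1 - κ) / 2)) := by
  have h1 := Real.Gamma_mul_Gamma_add_half (κ / 2)
  have h2 := Real.Gamma_mul_Gamma_one_sub ((κ + 1) / 2)
  have h3 : Real.sin (Real.pi * ((κ + 1) / 2)) = Real.cos (κ * Real.pi / 2) := by
    rw [← Real.sin_add_pi_div_two]; ring_nf
  rw [h3, show 1 - (κ + 1) / 2 = (1 - κ) / 2 by ring] at h2
  rw [show κ / 2 + 1 / 2 = (κ + 1) / 2 by ring, show 2 * (κ / 2) = κ by ring] at h1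
  have hc : 0 < Real.cos (κ * Real.pi / 2) := by
    refine Real.cos_pos_of_mem_Ioo ⟨?_, ?_⟩ <;> nlinarith [hκ.1, hκ.2, Real.pi_pos]
  have g1 := Real.Gamma_pos_of_pos hκ.1
  have g2 := Real.Gamma_pos_of_pos (half_pos hκ.1)
  have g3 : 0 < Real.Gamma ((κ + 1) / 2) := Real.Gamma_pos_of_pos (by linarith [hκ.1])
  have hp : 0 < √Real.pi := Real.sqrt_pos.2 Real.pi_pos
  have hpp : √Real.pi * √Real.pi = Real.pi := Real.mul_self_sqrt Real.pi_pos.le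
  rw [eq_div_iff hc.ne'] at h2
  rw [c₂, inv_mul_eq_div, inv_eq_iff_eq_inv, inv_div, eq_div_iff (by
    have : 0 < Real.Gamma ((1 - κ) / 2) := Real.Gamma_pos_of_pos (by linarith [hκ.2])
    positivity)]
  have h4 : Real.Gamma ((κ + 1) / 2) * (2 * Real.Gamma κ * Real.cos (κ * Real.pi / 2) *
      (2 ^ (1 - κ) * Real.Gamma ((1 - κ) / 2))) =
      Real.Gamma ((κ + 1) / 2) * (2 * √Real.pi * Real.Gamma (κ / 2)) := by
    calc _ = 2 * (Real.Gamma κ * 2 ^ (1 - κ)) *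
          (Real.Gamma ((κ + 1) / 2) * Real.Gamma ((1 - κ) / 2) * Real.cos (κ * Real.pi / 2)) := by
          ring
      _ = 2 * (Real.Gamma κ * 2 ^ (1 - κ) * √Real.pi) * √Real.pi := by rw [h2]; linear_combination (-2 * Real.Gamma κ * 2 ^ (1 - κ)) * hpp
      _ = _ := by rw [← h1]; ring
  exact mul_left_cancel₀ g3.ne' h4

/-- The density of the Gaussian mixture which represents the Riesz kernel. -/
def mixtureDensity (m : ℕ) (T κ : ℝ) (z : ℝ × ℝ) : ℝ :=
  z.1 ^ (-((1 - κ) / 2) - 1) * Real.exp (-(z.2 ^ 2 / 4 / z.1)) * Real.exp (-T * z.2 ^ m)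

/-- An inverse-Gamma integral with exponent b = (1-κ)/2 and rate a²/4: the power |a|^{-2b} is the
Riesz kernel on the frequency side. -/
theorem integral_mixtureDensity (hκ : κ ∈ Set.Ioo (0 : ℝ) 1) {a : ℝ} (ha : a ≠ 0) :
    ∫ τ in Set.Ioi (0 : ℝ), mixtureDensity m T κ (τ, a) =
      2 ^ (1 - κ) * Real.Gamma ((1 - κ) / 2) * (|a| ^ (κ - 1) * Real.exp (-T * a ^ m)) := by
  have ha' : 0 < |a| := abs_pos.2 ha
  simp only [mixtureDensity]
  rw [integral_mul_const, integral_Ioi_rpow_mul_exp_neg_inv (by linarith [hκ.2]) (by positivity)]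
  have h : (1 / (a ^ 2 / 4)) ^ ((1 - κ) / 2) = 2 ^ (1 - κ) * |a| ^ (κ - 1) := by
    rw [show 1 / (a ^ 2 / 4) = (2 * |a|⁻¹) ^ (2 : ℝ) by
      rw [Real.rpow_two, mul_pow, inv_pow, sq_abs]; field_simp; norm_num,
      ← Real.rpow_mul (by positivity), Real.mul_rpow (by norm_num) (by positivity),
      Real.inv_rpow ha'.le, ← Real.rpow_neg ha'.le]
    ring_nf
  rw [h]; ring

theorem mixtureDensity_nonneg {z : ℝ × ℝ} (hz : 0 < z.1) : 0 ≤ mixtureDensity m T κ z := by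
  unfold mixtureDensity; positivity

theorem measurable_mixtureDensity : Measurable (mixtureDensity m T κ) := by
  unfold mixtureDensity; fun_prop

/-- Tonelli with τ integrated first; the result is integrable near a = 0 because κ - 1 > -1. -/
theorem integrable_mixtureDensity (hm : Even m) (hm0 : 0 < m) (hT : 0 < T)
    (hκ : κ ∈ Set.Ioo (0 : ℝ) 1) :
    Integrable (mixtureDensity m T κ) ((volume.restrict (Set.Ioi 0)).prod volume) := by
  have h0 : ∀ᵐ a : ℝ, a ≠ 0 := by simp [ae_iff]
  have hpos {a : ℝ} (ha : a ≠ 0) : 0 < ∫ τ in Set.Ioi (0 : ℝ), mixtureDensity m T κ (τ, a) := by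
    rw [integral_mixtureDensity hκ ha]
    have : 0 < Real.Gamma ((1 - κ) / 2) := Real.Gamma_pos_of_pos (by linarith [hκ.2])
    have : 0 < |a| := abs_pos.2 ha
    positivity
  refine (integrable_prod_iff' measurable_mixtureDensity.aestronglyMeasurable).2 ⟨?_, ?_⟩
  · filter_upwards [h0] with a ha
    exact .of_integral_ne_zero (hpos ha).ne'
  · refine ((integrable_abs_rpow_mul_exp hm hm0 hT (q := κ - 1) (by linarith [hκ.1])).const_mul
      (2 ^ (1 - κ) * Real.Gamma ((1 - κ) / 2))).congr ?_
    filter_upwards [h0] with a ha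
    rw [← integral_mixtureDensity hκ ha]
    refine setIntegral_congr_fun measurableSet_Ioi fun τ hτ => ?_
    exact (Real.norm_of_nonneg (mixtureDensity_nonneg (z := (τ, a)) hτ)).symm

theorem integral_mixtureDensity_mul_cos (hm : Even m) (hm0 : 0 < m) (hT : 0 < T)
    (hκ : κ ∈ Set.Ioo (0 : ℝ) 1) (x : ℝ) :
    ∫ z, mixtureDensity m T κ z * Real.cos (z.2 * x) ∂((volume.restrict (Set.Ioi 0)).prod volume) =
      2 ^ (1 - κ) * Real.Gamma ((1 - κ) / 2) *
        ∫ l : ℝ, |l| ^ (κ - 1) * Real.cos (l * x) * Real.exp (-T * l ^ m) := by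
  have hi : Integrable (fun z : ℝ × ℝ => mixtureDensity m T κ z * Real.cos (z.2 * x))
      ((volume.restrict (Set.Ioi 0)).prod volume) :=
    (integrable_mixtureDensity hm hm0 hT hκ).mul_bdd (c := 1) (by fun_prop)
      (Eventually.of_forall fun a => Real.abs_cos_le_one _)
  rw [integral_prod_symm _ hi, ← integral_const_mul]
  have h0 : ∀ᵐ a : ℝ, a ≠ 0 := by simp [ae_iff]
  refine integral_congr_ae ?_
  filter_upwards [h0] with a ha
  rw [integral_mul_const, integral_mixtureDensity hκ ha]
  ring

theorem tendsto_integral_mixtureDensity (hm : Even m) (hm0 : 0 < m) (hT : 0 < T)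
    (hκ : κ ∈ Set.Ioo (0 : ℝ) 1) (x : ℝ) :
    Tendsto (fun ε : ℝ => ∫ z, Real.exp (-(ε * z.1)) * (mixtureDensity m T κ z *
        Real.cos (z.2 * x)) ∂((volume.restrict (Set.Ioi 0)).prod volume)) (𝓝[>] 0)
      (𝓝 (∫ z, mixtureDensity m T κ z * Real.cos (z.2 * x)
        ∂((volume.restrict (Set.Ioi 0)).prod volume))) := by
  have hpos : ∀ᵐ z : ℝ × ℝ ∂((volume.restrict (Set.Ioi 0)).prod volume), 0 < z.1 :=
    Measure.quasiMeasurePreserving_fst.ae (ae_restrict_mem measurableSet_Ioi)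
  refine tendsto_integral_filter_of_dominated_convergence (mixtureDensity m T κ) ?_ ?_
    (integrable_mixtureDensity hm hm0 hT hκ) ?_
  · refine Eventually.of_forall fun ε => ?_
    have := measurable_mixtureDensity (m := m) (T := T) (κ := κ)
    exact Measurable.aestronglyMeasurable (by fun_prop)
  · filter_upwards [self_mem_nhdsWithin] with ε hε
    filter_upwards [hpos] with z hz
    have hε' : 0 < ε := hε
    have h0 := mixtureDensity_nonneg (m := m) (T := T) (κ := κ) hz
    rw [norm_mul, norm_mul, Real.norm_of_nonneg h0, Real.norm_of_nonneg (Real.exp_pos _).le]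
    have h1 : Real.exp (-(ε * z.1)) ≤ 1 := Real.exp_le_one_iff.2 (by nlinarith)
    have h2 : ‖Real.cos (z.2 * x)‖ ≤ 1 := Real.abs_cos_le_one _
    calc _ ≤ 1 * (mixtureDensity m T κ z * 1) := by gcongr
      _ = _ := by ring
  · refine Eventually.of_forall fun z => ?_
    have : Tendsto (fun ε : ℝ => Real.exp (-(ε * z.1)) * (mixtureDensity m T κ z *
        Real.cos (z.2 * x))) (𝓝 0) (𝓝 (Real.exp (-(0 * z.1)) * (mixtureDensity m T κ z *
        Real.cos (z.2 * x)))) := Continuous.tendsto (by fun_prop) 0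
    simpa using this.mono_left nhdsWithin_le_nhds

theorem rpow_neg_eq_integral {q y : ℝ} (hq : 0 < q) (hy : 0 < y) :
    y ^ (-q) = (Real.Gamma q)⁻¹ * ∫ τ in Set.Ioi (0 : ℝ), τ ^ (q - 1) * Real.exp (-(y * τ)) := by
  rw [Real.integral_rpow_mul_exp_neg_mul_Ioi hq hy, one_div, Real.inv_rpow hy.le, Real.rpow_neg hy.le]
  have := Real.Gamma_pos_of_pos hq
  field_simp

/-- The power is a Gamma integral of exp(-(ε+s²)τ) over τ, and the s-integral is then the Fourier
transform of a Gaussian. For ε > 0 the weight is bounded by ε^{-κ/2}, so Fubini needs only the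
integrability of `fundSol`; on the mixture side ε survives merely as the factor exp(-ετ) ≤ 1. -/
theorem integral_add_sq_rpow_mul_fundSol (hm : Even m) (hm0 : 0 < m) (hT : 0 < T)
    (hκ : κ ∈ Set.Ioo (0 : ℝ) 1) (x : ℝ) {ε : ℝ} (hε : 0 < ε) :
    ∫ s : ℝ, (ε + s ^ 2) ^ (-(κ / 2)) * fundSol m T (x - s) =
      (2 * √Real.pi * Real.Gamma (κ / 2))⁻¹ * ∫ z, Real.exp (-(ε * z.1)) *
        (mixtureDensity m T κ z * Real.cos (z.2 * x))
        ∂((volume.restrict (Set.Ioi 0)).prod volume) := by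
  have hk : 0 < κ / 2 := half_pos hκ.1
  have hu : Integrable fun s => fundSol m T (x - s) := (integrable_fundSol hm hm0 hT).comp_sub_left x
  have hum := measurable_fundSol m T
  set f : ℝ → ℝ → ℝ := fun s τ => τ ^ (κ / 2 - 1) * Real.exp (-((ε + s ^ 2) * τ)) *
    fundSol m T (x - s) with hf
  have hfm : Measurable (Function.uncurry f) := by
    simp only [hf, Function.uncurry_def]; fun_prop
  have hpos (s : ℝ) : 0 < ε + s ^ 2 := by positivity
  have hg (s : ℝ) : ∫ τ in Set.Ioi (0 : ℝ), τ ^ (κ / 2 - 1) * Real.exp (-((ε + s ^ 2) * τ)) =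
      (ε + s ^ 2) ^ (-(κ / 2)) * Real.Gamma (κ / 2) := by
    have := Real.Gamma_pos_of_pos hk
    rw [rpow_neg_eq_integral hk (hpos s)]
    field_simp
  have hfint : Integrable (Function.uncurry f) (volume.prod (volume.restrict (Set.Ioi 0))) := by
    refine (integrable_prod_iff hfm.aestronglyMeasurable).2 ⟨Eventually.of_forall fun s => ?_, ?_⟩
    · simp only [Function.uncurry_apply_pair, hf]
      refine Integrable.mul_const (f := fun τ => τ ^ (κ / 2 - 1) * Real.exp (-((ε + s ^ 2) * τ)))
        (.of_integral_ne_zero ?_) _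
      rw [hg]
      have := Real.Gamma_pos_of_pos hk
      have := hpos s
      positivity
    · have : (fun s => ∫ τ in Set.Ioi (0 : ℝ), ‖Function.uncurry f (s, τ)‖) =
          fun s => (ε + s ^ 2) ^ (-(κ / 2)) * (Real.Gamma (κ / 2) * ‖fundSol m T (x - s)‖) := by
        funext s
        rw [← mul_assoc, ← hg, ← integral_mul_const]
        refine setIntegral_congr_fun measurableSet_Ioi fun τ hτ => ?_
        have hτ' : 0 < τ := hτ
        simp only [Function.uncurry_apply_pair, hf]
        rw [norm_mul, Real.norm_of_nonneg (by positivity)]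
      rw [this]
      refine (hu.norm.const_mul _).bdd_mul (c := ε ^ (-(κ / 2)))
        (Measurable.aestronglyMeasurable (by fun_prop))
        (Eventually.of_forall fun s => ?_)
      rw [Real.norm_of_nonneg (by have := hpos s; positivity)]
      exact Real.rpow_le_rpow_of_nonpos hε (by nlinarith) (by linarith)
  have hint : Integrable (fun z : ℝ × ℝ => Real.exp (-(ε * z.1)) *
        (mixtureDensity m T κ z * Real.cos (z.2 * x)))
        ((volume.restrict (Set.Ioi 0)).prod volume) := by
    have hpos : ∀ᵐ z : ℝ × ℝ ∂((volume.restrict (Set.Ioi 0)).prod volume), 0 < z.1 :=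
      Measure.quasiMeasurePreserving_fst.ae (ae_restrict_mem measurableSet_Ioi)
    refine ((integrable_mixtureDensity hm hm0 hT hκ).mul_bdd (c := 1) (by fun_prop)
      (Eventually.of_forall fun a => Real.abs_cos_le_one _)).bdd_mul (c := 1) (by fun_prop) ?_
    filter_upwards [hpos] with z hz
    rw [Real.norm_of_nonneg (Real.exp_pos _).le]
    exact Real.exp_le_one_iff.2 (by nlinarith)
  calc ∫ s : ℝ, (ε + s ^ 2) ^ (-(κ / 2)) * fundSol m T (x - s)
      = (Real.Gamma (κ / 2))⁻¹ * ∫ s : ℝ, ∫ τ in Set.Ioi (0 : ℝ), f s τ := by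
        rw [← integral_const_mul]
        congr 1
        funext s
        rw [rpow_neg_eq_integral hk (hpos s), mul_assoc, ← integral_mul_const]
    _ = (Real.Gamma (κ / 2))⁻¹ * ∫ τ in Set.Ioi (0 : ℝ), ∫ s : ℝ, f s τ := by
        rw [integral_integral_swap hfint]
    _ = (Real.Gamma (κ / 2))⁻¹ * ((2 * √Real.pi)⁻¹ * ∫ τ in Set.Ioi (0 : ℝ), ∫ a : ℝ,
          Real.exp (-(ε * τ)) * (mixtureDensity m T κ (τ, a) * Real.cos (a * x))) := by
        congr 1
        rw [← integral_const_mul]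
        refine setIntegral_congr_fun measurableSet_Ioi fun τ hτ => ?_
        have hτ' : 0 < τ := hτ
        have h1 : (fun s => f s τ) = fun s => (τ ^ (κ / 2 - 1) * Real.exp (-(ε * τ))) *
            (Real.exp (-τ * s ^ 2) * fundSol m T (x - s)) := by
          funext s
          simp only [hf]
          rw [show -((ε + s ^ 2) * τ) = -(ε * τ) + -τ * s ^ 2 by ring, Real.exp_add]
          ring
        simp only [h1]
        rw [integral_const_mul, integral_exp_neg_mul_sq_mul_fundSol hm hm0 hT hτ',
          ← integral_const_mul, ← integral_const_mul, ← integral_const_mul]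
        congr 1
        funext a
        -- The extra τ^{-1/2} is the normalization √(π/τ) of the Gaussian Fourier transform.
        have h2 : τ ^ (-((1 - κ) / 2) - 1) = τ ^ (κ / 2 - 1) * (√τ)⁻¹ := by
          rw [Real.sqrt_eq_rpow, ← Real.rpow_neg hτ'.le, ← Real.rpow_add hτ']
          ring_nf
        have h3 : a ^ 2 / 4 / τ = a ^ 2 / (4 * τ) := by rw [div_div]
        have hp : 0 < √Real.pi := Real.sqrt_pos.2 Real.pi_pos
        have hpp : Real.pi = √Real.pi * √Real.pi := (Real.mul_self_sqrt Real.pi_pos.le).symm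
        have h4 : (2 * Real.pi)⁻¹ * √Real.pi = (2 * √Real.pi)⁻¹ := by
          nth_rewrite 1 [hpp]
          field_simp
        rw [mixtureDensity, h2, h3, ← h4, Real.sqrt_div Real.pi_pos.le]
        ring
    _ = _ := by
        rw [integral_prod _ hint, ← mul_assoc, ← mul_inv, mul_comm (Real.Gamma _)]

/-- The Riesz potential of the fundamental solution, as a limit of regularized potentials. -/
theorem tendsto_integral_add_sq_rpow_mul_fundSol (hm : Even m) (hm0 : 0 < m) (hT : 0 < T)
    (hκ : κ ∈ Set.Ioo (0 : ℝ) 1) (x : ℝ) :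
    Tendsto (fun ε : ℝ => ∫ s : ℝ, (ε + s ^ 2) ^ (-(κ / 2)) * fundSol m T (x - s)) (𝓝[>] 0)
      (𝓝 (c₂ κ * ∫ l : ℝ, |l| ^ (κ - 1) * Real.cos (l * x) * Real.exp (-T * l ^ m))) := by
  have h := (tendsto_integral_mixtureDensity hm hm0 hT hκ x).const_mul
    (2 * √Real.pi * Real.Gamma (κ / 2))⁻¹
  rw [integral_mixtureDensity_mul_cos hm hm0 hT hκ, ← mul_assoc, ← c₂_eq hκ] at h
  refine h.congr' ?_
  filter_upwards [self_mem_nhdsWithin] with ε hε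
  rw [integral_add_sq_rpow_mul_fundSol hm hm0 hT hκ x hε]

end RieszPotential


/-! ### The limit of the rescaled covariance -/

section Covariance

variable {m : ℕ} {T : ℝ}

/-- The derivative decays like |s|^{-1-κ}, hence is integrable even when (1+s²)^{-κ/2} is not; this
is the gain from integrating by parts. -/
theorem integrable_deriv_one_add_sq_rpow {κ : ℝ} (hκ : 0 < κ) :
    Integrable fun s : ℝ => 2 * s * (-(κ / 2)) * (1 + s ^ 2) ^ (-(κ / 2) - 1) := by
  have h := (integrable_rpow_neg_one_add_norm_sq (E := ℝ) (μ := volume) (r := 1 + κ)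
    (by simpa using hκ)).const_mul κ
  refine h.mono' (Measurable.aestronglyMeasurable (by fun_prop)) (Eventually.of_forall fun s => ?_)
  have hp : 0 < 1 + s ^ 2 := by positivity
  have h1 : |s| ≤ (1 + s ^ 2) ^ (1 / 2 : ℝ) := by
    rw [← Real.sqrt_eq_rpow]
    exact Real.abs_le_sqrt (by linarith)
  have h2 : ‖2 * s * (-(κ / 2)) * (1 + s ^ 2) ^ (-(κ / 2) - 1)‖ =
      κ * (|s| * (1 + s ^ 2) ^ (-(κ / 2) - 1)) := by
    rw [norm_mul, Real.norm_of_nonneg (by positivity : 0 ≤ (1 + s ^ 2) ^ (-(κ / 2) - 1)),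
      Real.norm_eq_abs, show 2 * s * -(κ / 2) = -(κ * s) by ring, abs_neg, abs_mul,
      abs_of_pos hκ]
    ring
  rw [h2, Real.norm_eq_abs, sq_abs]
  gcongr
  calc |s| * (1 + s ^ 2) ^ (-(κ / 2) - 1)
      ≤ (1 + s ^ 2) ^ (1 / 2 : ℝ) * (1 + s ^ 2) ^ (-(κ / 2) - 1) := by gcongr
    _ = (1 + s ^ 2) ^ (-(1 + κ) / 2) := by
      rw [← Real.rpow_add hp]; ring_nf

theorem one_add_sq_rpow_le_one {q : ℝ} (hq : q ≤ 0) (s : ℝ) : (1 + s ^ 2) ^ q ≤ 1 :=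
  Real.rpow_le_one_of_one_le_of_nonpos (by nlinarith [sq_nonneg s]) hq

/-- The oscillating part of the covariance contributes boundedly to integrals against slowly
varying functions. -/
theorem exists_abs_integral_cos_mul_le (hm : Even m) (hm0 : 0 < m) (hT : 0 < T) {κ w : ℝ}
    (hκ : 0 < κ) (hw : w ≠ 0) (x : ℝ) :
    ∃ C, ∀ d : ℝ, 0 < d →
      |∫ s : ℝ, Real.cos (w * s) * ((1 + s ^ 2) ^ (-(κ / 2)) * fundSol m T (x - d * s))| ≤ C := by
  obtain ⟨C₁, hC₁⟩ := exists_abs_fundSol_le hm hm0 hT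
  obtain ⟨u', hu'i, hu'⟩ := exists_hasDerivAt_fundSol hm hm0 hT
  have hu := integrable_fundSol hm hm0 hT
  set B' : ℝ → ℝ := fun s => 2 * s * (-(κ / 2)) * (1 + s ^ 2) ^ (-(κ / 2) - 1) with hB'
  have hB'i : Integrable B' := integrable_deriv_one_add_sq_rpow hκ
  set B : ℝ → ℝ := fun s => (1 + s ^ 2) ^ (-(κ / 2)) with hB
  have hBd (s : ℝ) : HasDerivAt B (B' s) s := by
    have h : HasDerivAt (fun s : ℝ => 1 + s ^ 2) (2 * s) s := by
      simpa using (hasDerivAt_pow 2 s).const_add 1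
    exact h.rpow_const (Or.inl (by positivity))
  have hBm : Measurable B := by fun_prop
  have hB1 (s : ℝ) : ‖B s‖ ≤ 1 := by
    rw [Real.norm_of_nonneg (by positivity)]
    exact one_add_sq_rpow_le_one (by linarith) s
  -- The cosine is integrated to sin(ws)/w and the derivative falls on B(s)u(x-ds). The factor d
  -- from the chain rule cancels the Jacobian of s ↦ ds, so the bound is uniform in d.
  refine ⟨|w|⁻¹ * ((∫ s, |B' s|) * C₁ + ∫ s, |u' s|), fun d hd => ?_⟩
  have hvi {f : ℝ → ℝ} (hf : Integrable f) : Integrable fun s => f (x - d * s) :=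
    (hf.comp_sub_left x).comp_mul_left' hd.ne'
  have hvd (s : ℝ) : HasDerivAt (fun s => fundSol m T (x - d * s)) (-(d * u' (x - d * s))) s := by
    have h : HasDerivAt (fun s : ℝ => x - d * s) (-d) s := by
      simpa using ((hasDerivAt_id s).const_mul d).const_sub x
    convert! (hu' (x - d * s)).comp s h using 1
    ring
  set F' : ℝ → ℝ := fun s => B' s * fundSol m T (x - d * s) + B s * (-(d * u' (x - d * s)))
  have hFd (s : ℝ) : HasDerivAt (fun s => B s * fundSol m T (x - d * s)) (F' s) s :=
    (hBd s).mul (hvd s)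
  have i1 : Integrable fun s => B' s * fundSol m T (x - d * s) :=
    hB'i.mul_bdd (c := C₁)
      ((measurable_fundSol m T).comp (by fun_prop)).aestronglyMeasurable
      (Eventually.of_forall fun s => hC₁ _)
  have i2 : Integrable fun s => B s * (-(d * u' (x - d * s))) :=
    (((hvi hu'i).const_mul d).neg).bdd_mul (c := 1) hBm.aestronglyMeasurable
      (Eventually.of_forall hB1)
  have hF'i : Integrable F' := i1.add i2
  have hFi : Integrable fun s => B s * fundSol m T (x - d * s) :=
    (hvi hu).bdd_mul (c := 1) hBm.aestronglyMeasurable (Eventually.of_forall hB1)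
  have hsd (s : ℝ) : HasDerivAt (fun s => Real.sin (w * s) / w) (Real.cos (w * s)) s := by
    have h := (((hasDerivAt_id s).const_mul w).sin).div_const w
    convert! h using 1
    simp [hw]
  have hsb (s : ℝ) : ‖Real.sin (w * s) / w‖ ≤ |w|⁻¹ := by
    rw [norm_div, Real.norm_eq_abs, Real.norm_eq_abs, div_eq_mul_inv]
    exact mul_le_of_le_one_left (by positivity) (Real.abs_sin_le_one _)
  have key := integral_mul_deriv_eq_deriv_mul_of_integrable (fun s _ => hFd s) (fun s _ => hsd s)
    (hFi.mul_bdd (c := 1) (by fun_prop) (Eventually.of_forall fun a => Real.abs_cos_le_one _))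
    (hF'i.mul_bdd (c := |w|⁻¹) (by fun_prop) (Eventually.of_forall hsb))
    (hFi.mul_bdd (c := |w|⁻¹) (by fun_prop) (Eventually.of_forall hsb))
  have e : (fun s : ℝ => Real.cos (w * s) * ((1 + s ^ 2) ^ (-(κ / 2)) * fundSol m T (x - d * s))) =
      fun s => B s * fundSol m T (x - d * s) * Real.cos (w * s) := by
    funext s; simp only [hB]; ring
  rw [e, key, abs_neg]
  have hC₁0 : 0 ≤ C₁ := (abs_nonneg _).trans (hC₁ 0)
  calc |∫ s, F' s * (Real.sin (w * s) / w)|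
      ≤ ∫ s, |w|⁻¹ * (|B' s| * C₁ + d * |u' (x - d * s)|) := by
        have hi : Integrable fun s => |w|⁻¹ * (|B' s| * C₁ + d * |u' (x - d * s)|) :=
          ((hB'i.abs.mul_const _).add ((hvi hu'i).abs.const_mul d)).const_mul _
        rw [← Real.norm_eq_abs]
        refine norm_integral_le_of_norm_le hi (Eventually.of_forall fun s => ?_)
        rw [norm_mul, mul_comm]
        refine mul_le_mul (hsb s) ?_ (norm_nonneg _) (by positivity)
        refine (norm_add_le _ _).trans (add_le_add ?_ ?_)
        · rw [norm_mul]
          exact mul_le_mul_of_nonneg_left (hC₁ _) (norm_nonneg _)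
        · rw [norm_mul, norm_neg, norm_mul, Real.norm_of_nonneg hd.le]
          exact mul_le_of_le_one_left (by positivity) (hB1 s)
    _ = |w|⁻¹ * ((∫ s, |B' s|) * C₁ + ∫ s, |u' s|) := by
        rw [integral_const_mul, integral_add (hB'i.abs.mul_const _)
          ((hvi hu'i).abs.const_mul d), integral_mul_const, integral_const_mul]
        have h1 := Measure.integral_comp_mul_left (fun y => |u' (x - y)|) d
        rw [integral_sub_left_eq_self (fun y => |u' y|), abs_of_pos (by positivity),
          smul_eq_mul] at h1
        rw [h1, mul_inv_cancel_left₀ hd.ne']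

theorem initialCov_eq {n : ℕ} (A w κ : Fin (n + 1) → ℝ) (x : ℝ) :
    initialCov A w κ x = ∑ j, A j * (Real.cos (w j * x) * (1 + x ^ 2) ^ (-(κ j / 2))) := by
  unfold initialCov
  refine Finset.sum_congr rfl fun j _ => ?_
  rw [Real.rpow_neg (by positivity)]
  ring

theorem sqrt_pow_eq {ε : ℝ} (hε : 0 ≤ ε) (m : ℕ) : √(ε ^ m) = √ε ^ m := by
  rw [Real.sqrt_eq_rpow, Real.sqrt_eq_rpow, ← Real.rpow_natCast, ← Real.rpow_natCast,
    ← Real.rpow_mul hε, ← Real.rpow_mul hε, mul_comm]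

/-- The rescaled covariance of the solution converges to the covariance of the limit field. -/
theorem tendsto_rescaled_covariance (hm : Even m) (hm0 : 0 < m) (hT : 0 < T) {n : ℕ}
    {A w κ : Fin (n + 1) → ℝ} (hw0 : w 0 = 0) (hw : ∀ j, j ≠ 0 → w j ≠ 0)
    (hκ : ∀ j, κ j ∈ Set.Ioo (0 : ℝ) 1) (x : ℝ) :
    Tendsto (fun ε : ℝ => ε ^ (-κ 0 / 2) *
        ∫ s, initialCov A w κ (x / √ε - s) * fundSol m (T / √(ε ^ m)) s) (𝓝[>] 0)
      (𝓝 (A 0 * c₂ (κ 0) *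
        ∫ l : ℝ, |l| ^ (κ 0 - 1) * Real.cos (l * x) * Real.exp (-T * l ^ m))) := by
  -- The j-th contribution after the reflection s ↦ x/√ε - s; the inner √ε comes from
  -- self-similarity of `fundSol`.
  set G : Fin (n + 1) → ℝ → ℝ := fun j ε => ε ^ (-κ 0 / 2) * (√ε *
    ∫ s : ℝ, Real.cos (w j * s) * ((1 + s ^ 2) ^ (-(κ j / 2)) * fundSol m T (x - √ε * s))) with hG
  have hsum : ∀ ε : ℝ, 0 < ε → ε ^ (-κ 0 / 2) *
      ∫ s, initialCov A w κ (x / √ε - s) * fundSol m (T / √(ε ^ m)) s = ∑ j, A j * G j ε := by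
    intro ε hε
    have hd : 0 < √ε := Real.sqrt_pos.2 hε
    rw [← integral_sub_left_eq_self _ _ (x / √ε), sqrt_pow_eq hε.le]
    have h1 : (fun s => initialCov A w κ (x / √ε - (x / √ε - s)) *
        fundSol m (T / √ε ^ m) (x / √ε - s)) = fun s => ∑ j, A j * (√ε * (Real.cos (w j * s) *
        ((1 + s ^ 2) ^ (-(κ j / 2)) * fundSol m T (x - √ε * s)))) := by
      funext s
      rw [fundSol_div_pow hm hm0 hT hd, sub_sub_cancel, initialCov_eq, Finset.sum_mul, mul_sub,
        mul_div_cancel₀ _ hd.ne']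
      exact Finset.sum_congr rfl fun j _ => by ring
    have hi (j : Fin (n + 1)) : Integrable fun s => Real.cos (w j * s) *
        ((1 + s ^ 2) ^ (-(κ j / 2)) * fundSol m T (x - √ε * s)) := by
      refine ((((integrable_fundSol hm hm0 hT).comp_sub_left x).comp_mul_left' hd.ne').bdd_mul
        (c := 1) (Measurable.aestronglyMeasurable (by fun_prop)) (Eventually.of_forall fun s => ?_)
        ).bdd_mul (c := 1) (by fun_prop) (Eventually.of_forall fun a => Real.abs_cos_le_one _)
      rw [Real.norm_of_nonneg (by positivity)]
      exact one_add_sq_rpow_le_one (by linarith [(hκ j).1]) s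
    rw [h1, integral_finsetSum _ fun j _ => ((hi j).const_mul _).const_mul _, Finset.mul_sum]
    refine Finset.sum_congr rfl fun j _ => ?_
    rw [integral_const_mul, integral_const_mul]
    simp only [hG]
    ring
  -- For the non-oscillating term the scaling is exact: ε^{-κ₀/2}(1+s²)^{-κ₀/2} = (ε+(√ε
  -- s)²)^{-κ₀/2}, and √ε ds is the new measure.
  have hG0 : Tendsto (G 0) (𝓝[>] 0) (𝓝 (c₂ (κ 0) *
      ∫ l : ℝ, |l| ^ (κ 0 - 1) * Real.cos (l * x) * Real.exp (-T * l ^ m))) := by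
    refine (tendsto_integral_add_sq_rpow_mul_fundSol hm hm0 hT (hκ 0) x).congr' ?_
    filter_upwards [self_mem_nhdsWithin] with ε hε
    have hε' : 0 < ε := hε
    have hd : 0 < √ε := Real.sqrt_pos.2 hε'
    have h1 := Measure.integral_comp_mul_left
      (fun s => (ε + s ^ 2) ^ (-(κ 0 / 2)) * fundSol m T (x - s)) √ε
    rw [abs_of_pos (by positivity), smul_eq_mul, eq_inv_mul_iff_mul_eq₀ hd.ne'] at h1
    rw [← h1]
    simp only [hG, hw0, zero_mul, Real.cos_zero, one_mul]
    rw [mul_left_comm (ε ^ _)]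
    congr 1
    rw [← integral_const_mul]
    congr 1
    funext s
    rw [show ε + (√ε * s) ^ 2 = ε * (1 + s ^ 2) by rw [mul_pow, Real.sq_sqrt hε'.le]; ring,
      Real.mul_rpow hε'.le (by positivity), mul_assoc, neg_div]
  -- The prefactor ε^{(1-κ₀)/2} vanishes since κ₀ < 1, so no comparison between κ_j and κ₀ is
  -- needed.
  have hGj (j : Fin (n + 1)) (hj : j ≠ 0) : Tendsto (G j) (𝓝[>] 0) (𝓝 0) := by
    obtain ⟨C, hC⟩ := exists_abs_integral_cos_mul_le hm hm0 hT (hκ j).1 (hw j hj) x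
    have hq : 0 < (1 - κ 0) / 2 := by linarith [(hκ 0).2]
    have h0 : Tendsto (fun ε : ℝ => ε ^ ((1 - κ 0) / 2) * C) (𝓝[>] 0) (𝓝 0) := by
      have := ((Real.continuous_rpow_const hq.le).tendsto 0).mul_const C
      rw [Real.zero_rpow hq.ne', zero_mul] at this
      exact this.mono_left nhdsWithin_le_nhds
    refine squeeze_zero_norm' ?_ h0
    filter_upwards [self_mem_nhdsWithin] with ε hε
    have hε' : 0 < ε := hε
    simp only [hG]
    rw [← mul_assoc, norm_mul, Real.norm_of_nonneg (by positivity)]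
    have h2 : ε ^ (-κ 0 / 2) * √ε = ε ^ ((1 - κ 0) / 2) := by
      rw [Real.sqrt_eq_rpow, ← Real.rpow_add hε']; ring_nf
    rw [h2]
    exact mul_le_mul_of_nonneg_left (hC _ (Real.sqrt_pos.2 hε')) (by positivity)
  have hlim : Tendsto (fun ε => ∑ j, A j * G j ε) (𝓝[>] 0) (𝓝 (∑ j, A j *
      (if j = 0 then c₂ (κ 0) * ∫ l : ℝ, |l| ^ (κ 0 - 1) * Real.cos (l * x) * Real.exp (-T * l ^ m)
        else 0))) := by
    refine tendsto_finsetSum _ fun j _ => Tendsto.const_mul _ ?_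
    split_ifs with hj
    · rw [hj]; exact hG0
    · exact hGj j hj
  simp only [mul_ite, mul_zero, Finset.sum_ite_eq', Finset.mem_univ, if_true] at hlim
  rw [mul_assoc]
  refine hlim.congr' ?_
  filter_upwards [self_mem_nhdsWithin] with ε hε
  exact (hsum ε hε).symm

end Covariance


/-! ### The limit covariance as a Fox–Wright series -/

section FoxWright

variable {m : ℕ} {T κ : ℝ}

theorem integrable_limitCov (hm : Even m) (hm0 : 0 < m) (hT : 0 < T) (hκ : 0 < κ) (x : ℝ) :
    Integrable fun l : ℝ => |l| ^ (κ - 1) * Real.cos (l * x) * Real.exp (-T * l ^ m) := by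
  have h := (integrable_abs_rpow_mul_exp hm hm0 hT (q := κ - 1) (by linarith)).mul_bdd
    (g := fun l => Real.cos (l * x)) (c := 1) (by fun_prop)
    (Eventually.of_forall fun a => Real.abs_cos_le_one _)
  refine h.congr (Eventually.of_forall fun l => ?_)
  simp only
  ring

/-- Replacing cos by cosh dominates the absolute values of all partial sums of the cosine series.
The growth exp|lx| is absorbed by half of the exponent T l^m: for |l| ≥ 1 this is the inequality of
the means together with l² ≤ l^m, and for |l| ≤ 1 it is trivial. -/
theorem integrable_abs_rpow_mul_cosh (hm : Even m) (hm0 : 0 < m) (hT : 0 < T) (hκ : 0 < κ)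
    (x : ℝ) :
    Integrable fun l : ℝ => |l| ^ (κ - 1) * Real.cosh (l * x) * Real.exp (-T * l ^ m) := by
  have h := (integrable_abs_rpow_mul_exp hm hm0 (half_pos hT) (q := κ - 1)
    (by linarith)).const_mul (Real.exp (|x| + x ^ 2 / (2 * T)))
  refine h.mono' (Measurable.aestronglyMeasurable (by fun_prop)) (Eventually.of_forall fun l => ?_)
  have hcosh : Real.cosh (l * x) ≤ Real.exp |l * x| := by
    rw [← Real.cosh_abs, Real.cosh_eq]
    have := Real.exp_le_exp.2 (neg_le_self (abs_nonneg (l * x)))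
    linarith
  have hlm : |l * x| ≤ |x| + x ^ 2 / (2 * T) + T / 2 * l ^ m := by
    have hlm0 : 0 ≤ l ^ m := hm.pow_nonneg l
    have hx2 : 0 ≤ x ^ 2 / (2 * T) := by positivity
    rw [abs_mul]
    rcases le_total |l| 1 with hl | hl
    · have := mul_le_of_le_one_left (abs_nonneg x) hl
      have : 0 ≤ T / 2 * l ^ m := by positivity
      linarith
    · have h2 : 2 ≤ m := by
        obtain ⟨k, rfl⟩ := hm
        omega
      have hpow : l ^ 2 ≤ l ^ m := by
        rw [← hm.pow_abs, ← sq_abs]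
        exact pow_le_pow_right₀ hl h2
      have hy : |l| * |x| ≤ x ^ 2 / (2 * T) + T / 2 * l ^ 2 := by
        rw [← sq_abs x, ← sq_abs l]
        have : |x| ^ 2 / (2 * T) + T / 2 * |l| ^ 2 - |l| * |x| =
            (|x| - T * |l|) ^ 2 / (2 * T) := by
          field_simp
          ring
        have : 0 ≤ (|x| - T * |l|) ^ 2 / (2 * T) := by positivity
        linarith
      have := mul_le_mul_of_nonneg_left hpow (half_pos hT).le
      have := abs_nonneg x
      linarith
  have hcosh0 : 0 < Real.cosh (l * x) := Real.cosh_pos _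
  rw [Real.norm_of_nonneg (by positivity), mul_left_comm, mul_assoc]
  refine mul_le_mul_of_nonneg_left ?_ (by positivity)
  rw [← Real.exp_add]
  calc Real.cosh (l * x) * Real.exp (-T * l ^ m)
      ≤ Real.exp |l * x| * Real.exp (-T * l ^ m) := by gcongr
    _ ≤ _ := by
      rw [← Real.exp_add]
      exact Real.exp_le_exp.2 (by linarith)

/-- The terms of the expansion of the limit covariance into a power series. -/
def covTerm (m : ℕ) (T κ x : ℝ) (k : ℕ) (l : ℝ) : ℝ :=
  |l| ^ (κ - 1) * ((-1) ^ k * (l * x) ^ (2 * k) / ((2 * k).factorial : ℝ)) *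
    Real.exp (-T * l ^ m)

theorem norm_covTerm (x : ℝ) (k : ℕ) (l : ℝ) : ‖covTerm m T κ x k l‖ =
    |l| ^ (κ - 1) * ((l * x) ^ (2 * k) / ((2 * k).factorial : ℝ)) * Real.exp (-T * l ^ m) := by
  have h : 0 ≤ (l * x) ^ (2 * k) := (even_two_mul k).pow_nonneg _
  rw [covTerm, norm_mul, norm_mul, norm_div, norm_mul, norm_pow, norm_neg, norm_one, one_pow,
    one_mul, Real.norm_of_nonneg h, Real.norm_of_nonneg (Real.exp_pos _).le,
    Real.norm_of_nonneg (by positivity : 0 ≤ |l| ^ (κ - 1)), Real.norm_of_nonneg (by positivity)]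

theorem covTerm_ae_eq (x : ℝ) (k : ℕ) : covTerm m T κ x k =ᵐ[volume] fun l =>
    ((-1) ^ k * x ^ (2 * k) / ((2 * k).factorial : ℝ)) *
      (|l| ^ (κ - 1 + 2 * k) * Real.exp (-T * l ^ m)) := by
  have h0 : ∀ᵐ a : ℝ, a ≠ 0 := by simp [ae_iff]
  filter_upwards [h0] with l hl
  have h1 : |l| ^ (κ - 1 + 2 * k) = |l| ^ (κ - 1) * l ^ (2 * k) := by
    rw [Real.rpow_add (abs_pos.2 hl), ← (even_two_mul k).pow_abs, ← Real.rpow_natCast]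
    push_cast
    rfl
  rw [covTerm, h1, mul_pow]
  ring

theorem integrable_covTerm (hm : Even m) (hm0 : 0 < m) (hT : 0 < T) (hκ : 0 < κ) (x : ℝ) (k : ℕ) :
    Integrable (covTerm m T κ x k) := by
  refine Integrable.congr ?_ (covTerm_ae_eq x k).symm
  refine (integrable_abs_rpow_mul_exp hm hm0 hT ?_).const_mul _
  have : (0 : ℝ) ≤ k := k.cast_nonneg
  linarith

/-- The moment of order κ-1+2k gives Γ((κ+2k)/m). Duplication at k+1/2 rewrites 1/(2k)! as √π/(4^k
k! Γ(k+1/2)), whence the parameter (1/2, 1) and the 4 in the argument. -/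
theorem integral_covTerm (hm : Even m) (hm0 : 0 < m) (hT : 0 < T) (hκ : 0 < κ) (x : ℝ) (k : ℕ) :
    ∫ l, covTerm m T κ x k l = 2 * √Real.pi / (m * T ^ (κ / m)) *
      foxWrightTerm ![(κ / m, 2 / (m : ℝ))] ![(1 / 2, 1)] (-x ^ 2 / (4 * T ^ (2 / (m : ℝ)))) k := by
  have hk : (0 : ℝ) ≤ k := k.cast_nonneg
  have hm' : (0 : ℝ) < m := Nat.cast_pos.2 hm0
  rw [integral_congr_ae (covTerm_ae_eq x k), integral_const_mul,
    integral_abs_rpow_mul_exp hm hm0 hT (by linarith)]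
  have hdup := Real.Gamma_mul_Gamma_add_half ((k : ℝ) + 1 / 2)
  rw [show (k : ℝ) + 1 / 2 + 1 / 2 = k + 1 by ring,
    show 2 * ((k : ℝ) + 1 / 2) = ((2 * k : ℕ) : ℝ) + 1 by push_cast; ring,
    Real.Gamma_nat_eq_factorial, Real.Gamma_nat_eq_factorial,
    show 1 - (((2 * k : ℕ) : ℝ) + 1) = -((2 * k : ℕ) : ℝ) by ring, Real.rpow_neg (by norm_num),
    Real.rpow_natCast, pow_mul] at hdup
  have hG : Real.Gamma (k + 1 / 2) =
      (2 * k).factorial * √Real.pi / (4 ^ k * k.factorial) := by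
    rw [eq_div_iff (by positivity)]
    rw [show (2 : ℝ) ^ 2 = 4 by norm_num] at hdup
    calc _ = Real.Gamma (k + 1 / 2) * k.factorial * 4 ^ k := by ring
      _ = _ := by
        rw [hdup]
        field_simp
  have hTk : T ^ (-(κ - 1 + 2 * k + 1) / (m : ℝ)) =
      (T ^ (κ / m))⁻¹ * ((T ^ (2 / (m : ℝ))) ^ k)⁻¹ := by
    rw [← Real.rpow_natCast, ← Real.rpow_mul hT.le, ← Real.rpow_neg hT.le, ← Real.rpow_neg hT.le,
      ← Real.rpow_add hT]
    congr 1
    field_simp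
    ring
  have hp : 0 < √Real.pi := Real.sqrt_pos.2 Real.pi_pos
  simp only [foxWrightTerm, Finset.univ_unique, Fin.default_eq_zero, Finset.prod_singleton,
    Matrix.cons_val_fin_one, one_mul]
  rw [hTk, add_comm (1 / 2 : ℝ), hG, show (κ - 1 + 2 * k + 1) / (m : ℝ) = κ / m + 2 / m * k by
    field_simp; ring, div_pow, neg_pow (x ^ 2), mul_pow, ← pow_mul]
  have h1 : 0 < T ^ (κ / m) := by positivity
  have h2 : 0 < T ^ (2 / (m : ℝ)) := by positivity
  field_simp

/-- The limit covariance as a Fox–Wright series. -/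
theorem hasSum_foxWrightTerm (hm : Even m) (hm0 : 0 < m) (hT : 0 < T) (hκ : 0 < κ) (x : ℝ) :
    HasSum (foxWrightTerm ![(κ / m, 2 / (m : ℝ))] ![(1 / 2, 1)] (-x ^ 2 / (4 * T ^ (2 / (m : ℝ)))))
      ((2 * √Real.pi / (m * T ^ (κ / m)))⁻¹ *
        ∫ l : ℝ, |l| ^ (κ - 1) * Real.cos (l * x) * Real.exp (-T * l ^ m)) := by
  have hm' : (0 : ℝ) < m := Nat.cast_pos.2 hm0
  have hp : 0 < √Real.pi := Real.sqrt_pos.2 Real.pi_pos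
  have h1 : 0 < T ^ (κ / m) := by positivity
  have hi := integrable_covTerm hm hm0 hT hκ x
  have hsum : Summable fun k => ∫ l, ‖covTerm m T κ x k l‖ := by
    refine summable_of_sum_range_le
      (c := ∫ l : ℝ, |l| ^ (κ - 1) * Real.cosh (l * x) * Real.exp (-T * l ^ m))
      (fun k => integral_nonneg fun l => norm_nonneg _) fun N => ?_
    rw [← integral_finsetSum _ fun k _ => (hi k).norm]
    refine integral_mono (integrable_finsetSum _ fun k _ => (hi k).norm)
      (integrable_abs_rpow_mul_cosh hm hm0 hT hκ x) fun l => ?_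
    simp only [norm_covTerm]
    rw [← Finset.sum_mul, ← Finset.mul_sum]
    have := sum_le_hasSum (Finset.range N) (fun k _ => by
      have h : 0 ≤ (l * x) ^ (2 * k) := (even_two_mul k).pow_nonneg _
      positivity) (Real.hasSum_cosh (l * x))
    gcongr
  have h := hasSum_integral_of_summable_integral_norm hi hsum
  have htsum (l : ℝ) : ∑' k, covTerm m T κ x k l =
      |l| ^ (κ - 1) * Real.cos (l * x) * Real.exp (-T * l ^ m) :=
    (((Real.hasSum_cos (l * x)).mul_left _).mul_right _).tsum_eq
  simp only [htsum] at h
  refine (h.mul_left (2 * √Real.pi / (m * T ^ (κ / m)))⁻¹).congr_fun fun k => ?_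
  rw [integral_covTerm hm hm0 hT hκ, inv_mul_cancel_left₀ (by positivity)]

end FoxWright


/-! ### Gaussian Hilbert spaces -/

section GaussianHilbert

variable {Ω : Type*} [MeasurableSpace Ω] {P : Measure Ω}

/-- The characteristic function of the square integrable variable `U` at `1` is that of a centred
Gaussian variable. -/
def HasGaussianCharFun (U : Lp ℝ 2 P) : Prop :=
  ∫ ω, Complex.exp (U ω * Complex.I) ∂P = Complex.exp (-(‖U‖ ^ 2 / 2 : ℝ))

theorem norm_sq_eq_integral (U : Lp ℝ 2 P) : ‖U‖ ^ 2 = ∫ ω, U ω ^ 2 ∂P := by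
  rw [← real_inner_self_eq_norm_sq, L2.inner_def]
  congr 1
  funext ω
  simp [sq]

theorem norm_exp_mul_I_sub_le (a b : ℝ) :
    ‖Complex.exp (a * Complex.I) - Complex.exp (b * Complex.I)‖ ≤ ‖a - b‖ := by
  have h : Complex.exp (a * Complex.I) - Complex.exp (b * Complex.I) =
      Complex.exp (b * Complex.I) * (Complex.exp (Complex.I * (a - b : ℝ)) - 1) := by
    rw [mul_sub, ← Complex.exp_add]
    push_cast
    ring_nf
  rw [h, norm_mul, Complex.norm_exp_ofReal_mul_I, one_mul]
  exact Real.norm_exp_I_mul_ofReal_sub_one_le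

/-- The map x ↦ e^{ix} is 1-Lipschitz and the L¹ norm is at most the L² norm under a probability
measure. Hence the Gaussian condition is closed in L² and passes from a span to its closure. -/
theorem continuous_integral_exp_mul_I [IsProbabilityMeasure P] :
    Continuous fun U : Lp ℝ 2 P => ∫ ω, Complex.exp (U ω * Complex.I) ∂P := by
  refine LipschitzWith.continuous (K := 1) (LipschitzWith.of_dist_le_mul fun U V => ?_)
  have hi (U : Lp ℝ 2 P) : Integrable (fun ω => Complex.exp (U ω * Complex.I)) P := by
    refine Integrable.of_bound (C := 1) ?_ (Eventually.of_forall fun ω => ?_)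
    · have := (Lp.aestronglyMeasurable U)
      exact (Complex.continuous_exp.comp (by fun_prop : Continuous fun x : ℝ =>
        (x : ℂ) * Complex.I)).comp_aestronglyMeasurable this
    · rw [Complex.norm_exp_ofReal_mul_I]
  rw [dist_eq_norm, dist_eq_norm, ← integral_sub (hi U) (hi V), NNReal.coe_one, one_mul]
  have hUV : Integrable (fun ω => (U - V : Lp ℝ 2 P) ω) P := (Lp.memLp _).integrable (by norm_num)
  calc ‖∫ ω, (Complex.exp (U ω * Complex.I) - Complex.exp (V ω * Complex.I)) ∂P‖
      ≤ ∫ ω, ‖(U - V : Lp ℝ 2 P) ω‖ ∂P := by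
        refine norm_integral_le_of_norm_le hUV.norm ?_
        filter_upwards [Lp.coeFn_sub U V] with ω hω
        rw [hω]
        exact norm_exp_mul_I_sub_le _ _
    _ = (eLpNorm (U - V : Lp ℝ 2 P) 1 P).toReal := by
        rw [integral_norm_eq_lintegral_enorm hUV.1, eLpNorm_one_eq_lintegral_enorm]
    _ ≤ ‖U - V‖ := by
        rw [Lp.norm_def]
        exact ENNReal.toReal_mono (Lp.eLpNorm_ne_top _)
          (eLpNorm_le_eLpNorm_of_exponent_le (by norm_num) (Lp.aestronglyMeasurable _))

theorem isClosed_hasGaussianCharFun [IsProbabilityMeasure P] :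
    IsClosed {U : Lp ℝ 2 P | HasGaussianCharFun U} :=
  isClosed_eq continuous_integral_exp_mul_I (by fun_prop)

/-- The Gaussian Hilbert space generated by a family of square integrable variables. -/
def gaussianSpace {ι : Type*} {Y : ι → Ω → ℝ} (hY : ∀ i, MemLp (Y i) 2 P) :
    Submodule ℝ (Lp ℝ 2 P) :=
  (Submodule.span ℝ (Set.range fun i => (hY i).toLp)).topologicalClosure

theorem hasGaussianCharFun_of_mem_span {ι : Type*} {Y : ι → Ω → ℝ} (hG : IsGaussianProcess Y P)
    (hY : ∀ i, MemLp (Y i) 2 P) (h0 : ∀ i, ∫ ω, Y i ω ∂P = 0) {U : Lp ℝ 2 P}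
    (hU : U ∈ Submodule.span ℝ (Set.range fun i => (hY i).toLp)) : HasGaussianCharFun U := by
  have := hG.isProbabilityMeasure
  obtain ⟨c, rfl⟩ := (Finsupp.mem_span_range_iff_exists_finsupp).1 hU
  set U : Lp ℝ 2 P := c.sum fun i a => a • (hY i).toLp with hUdef
  have hae : (U : Ω → ℝ) =ᵐ[P] fun ω => ∑ i ∈ c.support, c i * Y i ω := by
    have h1 : (U : Ω → ℝ) =ᵐ[P]
        ∑ i ∈ c.support, ((c i • (hY i).toLp : Lp ℝ 2 P) : Ω → ℝ) := by
      rw [hUdef, Finsupp.sum]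
      exact Lp.coeFn_finsetSum _ _
    have h2 : ∀ i, ((c i • (hY i).toLp : Lp ℝ 2 P) : Ω → ℝ) =ᵐ[P] fun ω => c i * Y i ω := by
      intro i
      filter_upwards [Lp.coeFn_smul (c i) (hY i).toLp, (hY i).coeFn_toLp] with ω e1 e2
      rw [e1, Pi.smul_apply, e2, smul_eq_mul]
    have h3 : ∀ᵐ ω ∂P, ∀ i ∈ c.support,
        ((c i • (hY i).toLp : Lp ℝ 2 P) : Ω → ℝ) ω = c i * Y i ω :=
      (Finset.eventually_all _).2 fun i _ => h2 i
    filter_upwards [h1, h3] with ω e1 e3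
    rw [e1, Finset.sum_apply]
    exact Finset.sum_congr rfl e3
  have hgauss : HasGaussianLaw (U : Ω → ℝ) P := by
    have h := (hG.smul fun i => c i).hasGaussianLaw_fun_sum (I := c.support)
    exact h.congr hae.symm
  have hmean : ∫ ω, U ω ∂P = 0 := by
    rw [integral_congr_ae hae, integral_finsetSum _ fun i _ =>
      (((hY i).integrable (by norm_num)).const_mul _)]
    exact Finset.sum_eq_zero fun i _ => by rw [integral_const_mul, h0, mul_zero]
  have hvar : Var[(U : Ω → ℝ); P] = ‖U‖ ^ 2 := by
    rw [variance_of_integral_eq_zero hgauss.aemeasurable hmean, norm_sq_eq_integral]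
  have h := hgauss.charFun_map_eq 1
  rw [charFun_apply_real, integral_map hgauss.aemeasurable (by fun_prop)] at h
  simp only [RCLike.inner_apply, conj_trivial, mul_one] at h
  rw [hmean, hvar] at h
  rw [HasGaussianCharFun]
  convert! h using 2
  · simp
  · simp

theorem hasGaussianCharFun_of_mem {ι : Type*} {Y : ι → Ω → ℝ} (hG : IsGaussianProcess Y P)
    (hY : ∀ i, MemLp (Y i) 2 P) (h0 : ∀ i, ∫ ω, Y i ω ∂P = 0) {U : Lp ℝ 2 P}
    (hU : U ∈ gaussianSpace hY) : HasGaussianCharFun U := by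
  have := hG.isProbabilityMeasure
  exact closure_minimal (fun V hV => hasGaussianCharFun_of_mem_span hG hY h0 hV)
    isClosed_hasGaussianCharFun hU

/-- Testing characteristic functions at 1 suffices on a linear space: the value for X at t is the
value for tX at 1. -/
theorem map_eq_gaussianReal_of_submodule [IsProbabilityMeasure P] {K : Submodule ℝ (Lp ℝ 2 P)}
    (hK : ∀ U ∈ K, HasGaussianCharFun U) {X : Ω → ℝ} (hX : MemLp X 2 P) (hXK : hX.toLp ∈ K) :
    P.map X = gaussianReal 0 (‖hX.toLp‖₊ ^ 2) := by
  have hXm : AEMeasurable X P := hX.1.aemeasurable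
  have := Measure.isProbabilityMeasure_map hXm
  refine Measure.ext_of_charFun (funext fun t => ?_)
  rw [charFun_gaussianReal, charFun_apply_real, integral_map hXm (by fun_prop)]
  have h := hK _ (K.smul_mem t hXK)
  have hae : ∀ᵐ ω ∂P, (t • hX.toLp : Lp ℝ 2 P) ω = t * X ω := by
    filter_upwards [Lp.coeFn_smul t hX.toLp, hX.coeFn_toLp] with ω e1 e2
    rw [e1, Pi.smul_apply, e2, smul_eq_mul]
  rw [HasGaussianCharFun] at h
  rw [integral_congr_ae (g := fun ω => Complex.exp (t * X ω * Complex.I)) (by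
    filter_upwards [hae] with ω e
    rw [e]
    push_cast
    rfl)] at h
  rw [h, norm_smul]
  congr 1
  simp only [Real.norm_eq_abs, mul_pow, sq_abs, NNReal.coe_pow, coe_nnnorm]
  push_cast
  ring

theorem integral_eq_zero_of_submodule [IsProbabilityMeasure P] {K : Submodule ℝ (Lp ℝ 2 P)}
    (hK : ∀ U ∈ K, HasGaussianCharFun U) {X : Ω → ℝ} (hX : MemLp X 2 P) (hXK : hX.toLp ∈ K) :
    ∫ ω, X ω ∂P = 0 := by
  have h := integral_map (f := fun x : ℝ => x) hX.1.aemeasurable (by fun_prop)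
  rw [map_eq_gaussianReal_of_submodule hK hX hXK, integral_id_gaussianReal] at h
  exact h.symm

theorem toLp_sum_mem {ι : Type*} [Fintype ι] {K : Submodule ℝ (Lp ℝ 2 P)} {X : ι → Ω → ℝ}
    (hX : ∀ i, MemLp (X i) 2 P) (hXK : ∀ i, (hX i).toLp ∈ K) (c : ι → ℝ) :
    ∃ h : MemLp (fun ω => ∑ i, c i * X i ω) 2 P, h.toLp ∈ K := by
  have h : MemLp (fun ω => ∑ i, c i * X i ω) 2 P :=
    memLp_finsetSum _ fun i _ => (hX i).const_mul (c i)
  refine ⟨h, ?_⟩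
  have e : h.toLp = ∑ i, c i • (hX i).toLp := by
    refine Lp.ext ?_
    have h1 : ((∑ i, c i • (hX i).toLp : Lp ℝ 2 P) : Ω → ℝ) =ᵐ[P]
        ∑ i, ((c i • (hX i).toLp : Lp ℝ 2 P) : Ω → ℝ) := Lp.coeFn_finsetSum _ _
    have h3 : ∀ᵐ ω ∂P, ∀ i, ((c i • (hX i).toLp : Lp ℝ 2 P) : Ω → ℝ) ω = c i * X i ω := by
      refine eventually_all.2 fun i => ?_
      filter_upwards [Lp.coeFn_smul (c i) (hX i).toLp, (hX i).coeFn_toLp] with ω e1 e2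
      rw [e1, Pi.smul_apply, e2, smul_eq_mul]
    filter_upwards [h1, h3, h.coeFn_toLp] with ω e1 e3 e4
    rw [e1, e4, Finset.sum_apply]
    exact Finset.sum_congr rfl fun i _ => (e3 i).symm
  rw [e]
  exact K.sum_mem fun i _ => K.smul_mem _ (hXK i)

/-- Cramér–Wold: every linear functional of the vector is again an element of K. -/
theorem hasGaussianLaw_of_submodule [IsProbabilityMeasure P] {K : Submodule ℝ (Lp ℝ 2 P)}
    (hK : ∀ U ∈ K, HasGaussianCharFun U) {ι : Type*} [Fintype ι] {X : ι → Ω → ℝ}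
    (hX : ∀ i, MemLp (X i) 2 P) (hXK : ∀ i, (hX i).toLp ∈ K) :
    HasGaussianLaw (fun ω i => X i ω) P where
  isGaussian_map := by
    classical
    refine isGaussian_of_map_eq_gaussianReal fun L => ?_
    have hm : AEMeasurable (fun ω i => X i ω) P :=
      aemeasurable_pi_lambda _ fun i => (hX i).1.aemeasurable
    rw [AEMeasurable.map_map_of_aemeasurable (by fun_prop) hm]
    have hL : (L ∘ fun ω i => X i ω) = fun ω => ∑ i, L (Pi.single i 1) * X i ω := by
      funext ω
      have := L.toLinearMap.pi_apply_eq_sum_univ (fun i => X i ω)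
      simp only [ContinuousLinearMap.coe_coe, smul_eq_mul] at this
      rw [Function.comp_apply, this]
      exact Finset.sum_congr rfl fun i _ => by
        rw [mul_comm]
        congr 2
        funext j
        simp [Pi.single_apply, eq_comm]
    obtain ⟨h, hmem⟩ := toLp_sum_mem hX hXK fun i => L (Pi.single i 1)
    rw [hL]
    exact ⟨_, _, map_eq_gaussianReal_of_submodule hK h hmem⟩

theorem isGaussianProcess_of_submodule [IsProbabilityMeasure P] {K : Submodule ℝ (Lp ℝ 2 P)}
    (hK : ∀ U ∈ K, HasGaussianCharFun U) {T : Type*} {X : T → Ω → ℝ}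
    (hX : ∀ i, MemLp (X i) 2 P) (hXK : ∀ i, (hX i).toLp ∈ K) : IsGaussianProcess X P where
  hasGaussianLaw I := hasGaussianLaw_of_submodule hK (fun i : I => hX i) fun i => hXK i

end GaussianHilbert

/-! ### Convergence in law of centred Gaussian vectors -/

section Convergence

variable {Ω : Type*} [MeasurableSpace Ω] {P : Measure Ω} [IsProbabilityMeasure P]
  {Ω' : Type*} [MeasurableSpace Ω'] {P' : Measure Ω'} [IsProbabilityMeasure P']

theorem charFun_map_toLp_of_centered {k : ℕ} {X : Fin k → Ω → ℝ}
    (hX : HasGaussianLaw (fun ω i => X i ω) P) (h0 : ∀ i, ∫ ω, X i ω ∂P = 0)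
    (t : EuclideanSpace ℝ (Fin k)) :
    charFun (P.map fun ω => WithLp.toLp 2 fun i => X i ω) t =
      Complex.exp (-((∑ i, ∑ j, t i * t j * cov[X i, X j; P]) / 2 : ℝ)) := by
  have hXi (i : Fin k) : HasGaussianLaw (X i) P := hX.map (.proj (R := ℝ) i)
  have hm (i : Fin k) : MemLp (X i) 2 P := (hXi i).memLp_two
  have hX' : HasGaussianLaw (fun ω => WithLp.toLp 2 fun i => X i ω) P :=
    hX.map_fun (PiLp.continuousLinearEquiv 2 ℝ (fun _ : Fin k => ℝ)).symm.toContinuousLinearMap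
  rw [hX'.charFun_map_eq]
  have hin (ω : Ω) : inner ℝ t (WithLp.toLp 2 fun i => X i ω) = ∑ i, t i * X i ω := by
    simp [PiLp.inner_apply, mul_comm]
  simp only [hin]
  have hmean : ∫ ω, ∑ i, t i * X i ω ∂P = 0 := by
    rw [integral_finsetSum _ fun i _ => ((hm i).integrable (by norm_num)).const_mul _]
    exact Finset.sum_eq_zero fun i _ => by rw [integral_const_mul, h0, mul_zero]
  have hvar : Var[fun ω => ∑ i, t i * X i ω; P] = ∑ i, ∑ j, t i * t j * cov[X i, X j; P] := by
    rw [variance_fun_sum fun i => (hm i).const_mul (t i)]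
    refine Finset.sum_congr rfl fun i _ => Finset.sum_congr rfl fun j _ => ?_
    rw [covariance_const_mul_left, covariance_const_mul_right, mul_assoc]
  rw [hmean, hvar]
  push_cast
  ring_nf

/-- Centred Gaussian vectors converge in distribution when their covariances converge. -/
theorem tendstoInDistribution_of_tendsto_covariance {ι : Type*} {l : Filter ι}
    [l.IsCountablyGenerated] {k : ℕ} {X : ι → Fin k → Ω → ℝ} {Z : Fin k → Ω' → ℝ}
    (hm : ∀ ε, AEMeasurable (fun ω i => X ε i ω) P)
    (hX : ∀ᶠ ε in l, HasGaussianLaw (fun ω i => X ε i ω) P)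
    (hX0 : ∀ᶠ ε in l, ∀ i, ∫ ω, X ε i ω ∂P = 0)
    (hZ : HasGaussianLaw (fun ω i => Z i ω) P') (hZ0 : ∀ i, ∫ ω, Z i ω ∂P' = 0)
    (hcov : ∀ i j, Tendsto (fun ε => cov[X ε i, X ε j; P]) l (𝓝 cov[Z i, Z j; P'])) :
    TendstoInDistribution (fun ε ω i => X ε i ω) l (fun ω i => Z i ω) (fun _ => P) P' := by
  have hcont : Continuous fun x : Fin k → ℝ => (WithLp.toLp 2 x : EuclideanSpace ℝ (Fin k)) :=
    PiLp.continuous_toLp 2 _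
  have hcont' : Continuous fun x : EuclideanSpace ℝ (Fin k) => (x.ofLp : Fin k → ℝ) :=
    PiLp.continuous_ofLp 2 _
  -- Characteristic functions need an inner product, so the vectors are moved to `EuclideanSpace`
  -- and brought back by a continuous map.
  have hE : TendstoInDistribution
      (fun ε ω => (WithLp.toLp 2 fun i => X ε i ω : EuclideanSpace ℝ (Fin k))) l
      (fun ω => WithLp.toLp 2 fun i => Z i ω) (fun _ => P) P' := by
    refine ⟨fun ε => hcont.measurable.comp_aemeasurable (hm ε),
      hcont.measurable.comp_aemeasurable hZ.aemeasurable, ?_⟩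
    -- Lévy's continuity theorem is used along sequences, which determine convergence along a
    -- countably generated filter.
    refine tendsto_of_seq_tendsto fun u hu => ProbabilityMeasure.tendsto_of_tendsto_charFun
      fun t => ?_
    simp only [ProbabilityMeasure.coe_mk]
    rw [charFun_map_toLp_of_centered hZ hZ0]
    have hlim : Tendsto (fun n => Complex.exp
        (-((∑ i, ∑ j, t i * t j * cov[X (u n) i, X (u n) j; P]) / 2 : ℝ))) atTop
        (𝓝 (Complex.exp (-((∑ i, ∑ j, t i * t j * cov[Z i, Z j; P']) / 2 : ℝ)))) := by
      refine (Complex.continuous_exp.tendsto _).comp (Tendsto.neg ?_)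
      refine (Complex.continuous_ofReal.tendsto _).comp (Tendsto.div_const ?_ _)
      exact tendsto_finsetSum _ fun i _ => tendsto_finsetSum _ fun j _ =>
        ((hcov i j).comp hu).const_mul _
    refine hlim.congr' ?_
    filter_upwards [hu.eventually hX, hu.eventually hX0] with n h1 h2
    exact (charFun_map_toLp_of_centered h1 h2 t).symm
  exact hE.continuous_comp hcont'

end Convergence


/-! ### Integrals of a second-order process against a kernel -/

section RandomIntegral

variable {Ω : Type*} [MeasurableSpace Ω] {P : Measure Ω} [IsProbabilityMeasure P]
  {ζ : ℝ → Ω → ℝ} {C : ℝ} {g : ℝ → ℝ}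

theorem integrable_sq_mul_abs (hζ : Measurable (Function.uncurry ζ)) (h2 : ∀ y, MemLp (ζ y) 2 P)
    (hC : ∀ y, ∫ ω, ζ y ω ^ 2 ∂P ≤ C) (hg : Integrable g) (hgm : Measurable g) :
    Integrable (fun z : ℝ × Ω => ζ z.1 z.2 ^ 2 * |g z.1|) (volume.prod P) := by
  have hm : Measurable fun z : ℝ × Ω => ζ z.1 z.2 := hζ
  have hm2 : Measurable fun z : ℝ × Ω => ζ z.1 z.2 ^ 2 := hm.pow_const 2
  refine (integrable_prod_iff (Measurable.aestronglyMeasurable (by fun_prop))).2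
    ⟨Eventually.of_forall fun y => (h2 y).integrable_sq.mul_const |g y|, ?_⟩
  have e : (fun y => ∫ ω, ‖ζ y ω ^ 2 * |g y|‖ ∂P) = fun y => (∫ ω, ζ y ω ^ 2 ∂P) * |g y| := by
    funext y
    rw [← integral_mul_const]
    congr 1
    funext ω
    rw [Real.norm_of_nonneg (by positivity)]
  simp only [e]
  refine hg.abs.bdd_mul (c := C) ?_ (Eventually.of_forall fun y => ?_)
  · exact (StronglyMeasurable.integral_prod_right' (f := fun z : ℝ × Ω => ζ z.1 z.2 ^ 2)
      hm2.stronglyMeasurable).aestronglyMeasurable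
  · rw [Real.norm_of_nonneg (integral_nonneg fun ω => sq_nonneg _)]
    exact hC y

theorem integrable_mul_mul (hζ : Measurable (Function.uncurry ζ)) (h2 : ∀ y, MemLp (ζ y) 2 P)
    (hC : ∀ y, ∫ ω, ζ y ω ^ 2 ∂P ≤ C) (hg : Integrable g) (hgm : Measurable g) {Z : Ω → ℝ}
    (hZ : MemLp Z 2 P) :
    Integrable (fun z : ℝ × Ω => Z z.2 * ζ z.1 z.2 * g z.1) (volume.prod P) := by
  have hm : Measurable fun z : ℝ × Ω => ζ z.1 z.2 := hζ
  have h1 : Integrable (fun z : ℝ × Ω => |g z.1| * Z z.2 ^ 2) (volume.prod P) :=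
    hg.abs.mul_prod hZ.integrable_sq
  refine (h1.add (integrable_sq_mul_abs hζ h2 hC hg hgm)).mono' ?_
    (Eventually.of_forall fun z => ?_)
  · exact (hZ.1.comp_snd.mul hm.aestronglyMeasurable).mul
      (hgm.comp measurable_fst).aestronglyMeasurable
  · simp only [Pi.add_apply]
    rw [norm_mul, norm_mul, Real.norm_eq_abs, Real.norm_eq_abs, Real.norm_eq_abs]
    have h : |Z z.2| * |ζ z.1 z.2| ≤ Z z.2 ^ 2 + ζ z.1 z.2 ^ 2 := by
      rw [← sq_abs (Z z.2), ← sq_abs (ζ z.1 z.2)]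
      nlinarith [sq_nonneg (|Z z.2| - |ζ z.1 z.2|), sq_nonneg (|Z z.2|), sq_nonneg (|ζ z.1 z.2|)]
    have := mul_le_mul_of_nonneg_right h (abs_nonneg (g z.1))
    linarith

theorem integrable_uncurry_mul (hζ : Measurable (Function.uncurry ζ)) (h2 : ∀ y, MemLp (ζ y) 2 P)
    (hC : ∀ y, ∫ ω, ζ y ω ^ 2 ∂P ≤ C) (hg : Integrable g) (hgm : Measurable g) :
    Integrable (fun z : ℝ × Ω => ζ z.1 z.2 * g z.1) (volume.prod P) := by
  simpa using integrable_mul_mul hζ h2 hC hg hgm (memLp_const (1 : ℝ))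

/-- Weighted Cauchy–Schwarz, from integrating (|f|-c)²|g| ≥ 0. The +1 keeps the choice c = N/(G+1)
meaningful when g has zero mass. -/
theorem sq_integral_mul_le {f : ℝ → ℝ} (hg : Integrable g) (hfg : Integrable fun y => f y * g y)
    (hf2 : Integrable fun y => f y ^ 2 * |g y|) :
    (∫ y, f y * g y) ^ 2 ≤ ((∫ y, |g y|) + 1) * ∫ y, f y ^ 2 * |g y| := by
  set G := ∫ y, |g y|
  have hG : 0 ≤ G := integral_nonneg fun y => abs_nonneg _
  set N := ∫ y, |f y| * |g y| with hN
  have hN0 : 0 ≤ N := integral_nonneg fun y => by positivity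
  have hNi : Integrable fun y => |f y| * |g y| := by simpa [abs_mul] using hfg.abs
  have h1 : |∫ y, f y * g y| ≤ N := by
    rw [← Real.norm_eq_abs]
    refine (norm_integral_le_integral_norm _).trans_eq ?_
    simp [hN]
  set c := N / (G + 1) with hc
  have h2 : 2 * c * N ≤ (∫ y, f y ^ 2 * |g y|) + c ^ 2 * G := by
    rw [hN, ← integral_const_mul, ← integral_const_mul, ← integral_add hf2 (hg.abs.const_mul _)]
    refine integral_mono (hNi.const_mul _) (hf2.add (hg.abs.const_mul _)) fun y => ?_
    have : 0 ≤ (|f y| - c) ^ 2 * |g y| := by positivity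
    simp only
    rw [← sq_abs (f y)]
    linarith
  have hcN : N = c * (G + 1) := by rw [hc]; field_simp
  calc (∫ y, f y * g y) ^ 2 ≤ N ^ 2 := by
        rw [← sq_abs]
        gcongr
    _ ≤ _ := by
        have h3 : c ^ 2 * (G + 1) ≤ ∫ y, f y ^ 2 * |g y| := by nlinarith [sq_nonneg c]
        calc N ^ 2 = (G + 1) * (c ^ 2 * (G + 1)) := by rw [hcN]; ring
          _ ≤ _ := by gcongr

theorem memLp_integral_mul (hζ : Measurable (Function.uncurry ζ)) (h2 : ∀ y, MemLp (ζ y) 2 P)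
    (hC : ∀ y, ∫ ω, ζ y ω ^ 2 ∂P ≤ C) (hg : Integrable g) (hgm : Measurable g) :
    MemLp (fun ω => ∫ y, ζ y ω * g y) 2 P := by
  have i1 := integrable_uncurry_mul hζ h2 hC hg hgm
  have i2 := integrable_sq_mul_abs hζ h2 hC hg hgm
  have hm : AEStronglyMeasurable (fun ω => ∫ y, ζ y ω * g y) P := i1.integral_prod_right.1
  refine (memLp_two_iff_integrable_sq hm).2 ?_
  refine (i2.integral_prod_right.const_mul ((∫ y, |g y|) + 1)).mono' (hm.pow 2) ?_
  filter_upwards [i1.prod_left_ae, i2.prod_left_ae] with ω h1 h2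
  rw [Real.norm_of_nonneg (sq_nonneg _)]
  exact sq_integral_mul_le hg h1 h2

theorem integral_mul_integral_mul (hζ : Measurable (Function.uncurry ζ))
    (h2 : ∀ y, MemLp (ζ y) 2 P) (hC : ∀ y, ∫ ω, ζ y ω ^ 2 ∂P ≤ C) (hg : Integrable g)
    (hgm : Measurable g) {Z : Ω → ℝ} (hZ : MemLp Z 2 P) :
    ∫ ω, Z ω * (∫ y, ζ y ω * g y) ∂P = ∫ y, (∫ ω, Z ω * ζ y ω ∂P) * g y := by
  have h := integral_integral_swap (f := fun y ω => Z ω * ζ y ω * g y)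
    (integrable_mul_mul hζ h2 hC hg hgm hZ)
  simp only [integral_mul_const] at h
  rw [h]
  congr 1
  funext ω
  rw [← integral_const_mul]
  simp only [mul_assoc]

/-- By Fubini, a variable orthogonal to every ζ y is orthogonal to the integral, so the integral
lies in the double orthogonal complement. Joint measurability replaces the path continuity that
Riemann sums would require. -/
theorem toLp_integral_mul_mem (hζ : Measurable (Function.uncurry ζ)) (h2 : ∀ y, MemLp (ζ y) 2 P)
    (hC : ∀ y, ∫ ω, ζ y ω ^ 2 ∂P ≤ C) (hg : Integrable g) (hgm : Measurable g)
    (hV : MemLp (fun ω => ∫ y, ζ y ω * g y) 2 P) {K : Submodule ℝ (Lp ℝ 2 P)}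
    (hK : ∀ y, (h2 y).toLp ∈ K) : hV.toLp ∈ K.topologicalClosure := by
  rw [← Submodule.orthogonal_orthogonal_eq_closure, Submodule.mem_orthogonal]
  intro Z hZ
  have key (W : Ω → ℝ) (hW : MemLp W 2 P) : inner ℝ Z hW.toLp = ∫ ω, Z ω * W ω ∂P := by
    rw [L2.inner_def]
    refine integral_congr_ae ?_
    filter_upwards [hW.coeFn_toLp] with ω e
    rw [e]
    simp [mul_comm]
  rw [key, integral_mul_integral_mul hζ h2 hC hg hgm (Lp.memLp Z)]
  refine integral_eq_zero_of_ae (Eventually.of_forall fun y => ?_)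
  have := (Submodule.mem_orthogonal' K Z).1 hZ _ (hK y)
  rw [key] at this
  simp [this]

end RandomIntegral

/-! ### The solution with random initial condition -/

section RandomInitialCondition

variable {Ω : Type*} [MeasurableSpace Ω] {P : Measure Ω}
  {m : ℕ} {n : ℕ} {A w κ : Fin (n + 1) → ℝ} {η : ℝ → Ω → ℝ} {M : ℝ → ℝ}

theorem continuous_initialCov : Continuous (initialCov A w κ) := by
  rw [funext (initialCov_eq A w κ)]
  refine continuous_finsetSum _ fun j _ => ?_
  refine continuous_const.mul (Continuous.mul (by fun_prop) ?_)
  exact Continuous.rpow_const (by fun_prop) fun x => Or.inl (by positivity)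

theorem abs_initialCov_le (hκ : ∀ j, κ j ∈ Set.Ioo (0 : ℝ) 1) (x : ℝ) :
    |initialCov A w κ x| ≤ ∑ j, |A j| := by
  rw [initialCov_eq]
  refine (Finset.abs_sum_le_sum_abs _ _).trans (Finset.sum_le_sum fun j _ => ?_)
  rw [abs_mul, abs_mul]
  refine mul_le_of_le_one_right (abs_nonneg _) (mul_le_one₀ (Real.abs_cos_le_one _) (abs_nonneg _) ?_)
  rw [abs_of_nonneg (by positivity)]
  exact one_add_sq_rpow_le_one (by linarith [(hκ j).1]) x

/-- The assumptions on the centred initial condition: a measurable centred Gaussian process with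
covariance function `r`. -/
structure IsStationaryGaussian (P : Measure Ω) (ξ : ℝ → Ω → ℝ) (r : ℝ → ℝ) : Prop where
  measurable : Measurable (Function.uncurry ξ)
  gaussian : IsGaussianProcess ξ P
  mean_zero : ∀ x, ∫ ω, ξ x ω ∂P = 0
  covariance : ∀ x y, ∫ ω, ξ x ω * ξ y ω ∂P = r (y - x)

variable {ξ : ℝ → Ω → ℝ} {r : ℝ → ℝ}

theorem IsStationaryGaussian.memLp (h : IsStationaryGaussian P ξ r) (x : ℝ) : MemLp (ξ x) 2 P :=
  (h.gaussian.hasGaussianLaw_eval x).memLp_two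

theorem IsStationaryGaussian.measurable_comp (h : IsStationaryGaussian P ξ r) (x : ℝ) :
    Measurable (Function.uncurry fun y => ξ (x - y)) :=
  h.measurable.comp ((measurable_const.sub measurable_fst).prodMk measurable_snd)

theorem IsStationaryGaussian.integral_sq (h : IsStationaryGaussian P ξ r) (x : ℝ) :
    ∫ ω, ξ x ω ^ 2 ∂P ≤ r 0 := by
  simp only [sq]
  rw [h.covariance, sub_self]

theorem IsStationaryGaussian.hasGaussianCharFun (h : IsStationaryGaussian P ξ r) :
    ∀ U ∈ gaussianSpace h.memLp, HasGaussianCharFun U :=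
  fun _ hU => hasGaussianCharFun_of_mem h.gaussian h.memLp h.mean_zero hU

variable [IsProbabilityMeasure P]

theorem isStationaryGaussian_sub_mean (hη_meas : Measurable (Function.uncurry η))
    (hη_gauss : IsGaussianProcess η P) (hM : ∀ x, ∫ ω, η x ω ∂P = M x)
    (hη_cov : ∀ y x, cov[η y, η (y + x); P] = initialCov A w κ x) :
    IsStationaryGaussian P (fun x ω => η x ω - M x) (initialCov A w κ) := by
  have hm : Measurable fun z : ℝ × Ω => η z.1 z.2 := hη_meas
  -- Measurability of the mean is inherited from the joint measurability of η.
  have hMm : Measurable M := by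
    rw [← funext hM]
    exact (StronglyMeasurable.integral_prod_right' (f := fun z : ℝ × Ω => η z.1 z.2)
      hm.stronglyMeasurable).measurable
  have hηi (x : ℝ) : Integrable (η x) P := (hη_gauss.hasGaussianLaw_eval x).integrable
  refine ⟨?_, ⟨fun I => ?_⟩, fun x => ?_, fun x y => ?_⟩
  · exact hm.sub (hMm.comp measurable_fst)
  · have h := (hη_gauss.hasGaussianLaw I).isGaussian_map
    have hg : HasGaussianLaw (fun ω => I.restrict (η · ω) - fun i : I => M i) P := by
      constructor
      have e : (P.map fun ω => I.restrict (η · ω) - fun i : I => M i) =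
          (P.map fun ω => I.restrict (η · ω)).map fun x => x - fun i : I => M i := by
        rw [AEMeasurable.map_map_of_aemeasurable (by fun_prop)
          (hη_gauss.hasGaussianLaw I).aemeasurable]
        rfl
      rw [e]
      infer_instance
    exact hg
  · rw [integral_sub (hηi x) (integrable_const _), hM]
    simp
  · have h := hη_cov x (y - x)
    rw [add_sub_cancel, covariance, hM, hM] at h
    exact h

/-- The stochastic part of the solution. -/
def randomConv (m : ℕ) (ξ : ℝ → Ω → ℝ) (t x : ℝ) (ω : Ω) : ℝ :=
  ∫ y, ξ (x - y) ω * fundSol m t y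

theorem IsStationaryGaussian.memLp_randomConv (h : IsStationaryGaussian P ξ r) (hm : Even m)
    (hm0 : 0 < m) {t : ℝ} (ht : 0 < t) (x : ℝ) : MemLp (randomConv m ξ t x) 2 P :=
  memLp_integral_mul (h.measurable_comp x) (fun _ => h.memLp _) (fun _ => h.integral_sq _)
    (integrable_fundSol hm hm0 ht) (measurable_fundSol m t)

theorem IsStationaryGaussian.toLp_randomConv_mem (h : IsStationaryGaussian P ξ r) (hm : Even m)
    (hm0 : 0 < m) {t : ℝ} (ht : 0 < t) (x : ℝ) :
    (h.memLp_randomConv hm hm0 ht x).toLp ∈ gaussianSpace h.memLp :=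
  toLp_integral_mul_mem (h.measurable_comp x) (fun _ => h.memLp _) (fun _ => h.integral_sq _)
    (integrable_fundSol hm hm0 ht) (measurable_fundSol m t) _
    fun y => Submodule.subset_span ⟨x - y, rfl⟩

theorem IsStationaryGaussian.integral_randomConv (h : IsStationaryGaussian P ξ r) (hm : Even m)
    (hm0 : 0 < m) {t : ℝ} (ht : 0 < t) (x : ℝ) : ∫ ω, randomConv m ξ t x ω ∂P = 0 :=
  integral_eq_zero_of_submodule h.hasGaussianCharFun _ (h.toLp_randomConv_mem hm hm0 ht x)

/-- Fubini, once for each convolution, leaves r integrated against a product of two fundamental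
solutions; translating one variable exposes their convolution, which the semigroup property
collapses. -/
theorem IsStationaryGaussian.integral_randomConv_mul (h : IsStationaryGaussian P ξ r)
    (hr : Continuous r) {C : ℝ} (hrC : ∀ x, |r x| ≤ C) (hr_even : ∀ x, r (-x) = r x)
    (hm : Even m) (hm0 : 0 < m) {t t' : ℝ} (ht : 0 < t) (ht' : 0 < t') (x x' : ℝ) :
    ∫ ω, randomConv m ξ t x ω * randomConv m ξ t' x' ω ∂P =
      ∫ s, r (x - x' - s) * fundSol m (t + t') s := by
  have hC (x y : ℝ) : ∫ ω, ξ (x - y) ω ^ 2 ∂P ≤ r 0 := h.integral_sq _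
  have hu := integrable_fundSol hm hm0 ht
  have hu' := integrable_fundSol hm hm0 ht'
  have hum := measurable_fundSol m t
  have hum' := measurable_fundSol m t'
  have h1 : ∫ ω, randomConv m ξ t x ω * randomConv m ξ t' x' ω ∂P =
      ∫ y', (∫ y, r (x' - y' - (x - y)) * fundSol m t y) * fundSol m t' y' := by
    have e := integral_mul_integral_mul (h.measurable_comp x') (fun _ => h.memLp _) (hC x') hu'
      hum' (h.memLp_randomConv hm hm0 ht x)
    refine e.trans ?_
    congr 1
    funext y'
    congr 1
    have e2 := integral_mul_integral_mul (h.measurable_comp x) (fun _ => h.memLp _) (hC x) hu hum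
      (h.memLp (x' - y'))
    simp only [mul_comm (randomConv m ξ t x _)]
    refine e2.trans ?_
    congr 1
    funext y
    rw [h.covariance, ← hr_even]
    ring_nf
  have hint : Integrable (fun z : ℝ × ℝ => r (x - x' - z.2) * (fundSol m t (z.2 + z.1) *
      fundSol m t' z.1)) (volume.prod volume) := by
    have h0 : Integrable (fun z : ℝ × ℝ => fundSol m t' z.1 * fundSol m t (z.2 + z.1))
        (volume.prod volume) := by
      refine (integrable_prod_iff (Measurable.aestronglyMeasurable (by fun_prop))).2
        ⟨Eventually.of_forall fun y => (hu.comp_add_right y).const_mul (fundSol m t' y), ?_⟩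
      have e (y : ℝ) : ∫ s, ‖fundSol m t' y * fundSol m t (s + y)‖ =
          ‖fundSol m t' y‖ * ∫ s, ‖fundSol m t s‖ := by
        simp only [norm_mul]
        rw [integral_const_mul, integral_add_right_eq_self fun s => ‖fundSol m t s‖]
      simp only [e]
      exact hu'.norm.mul_const _
    refine (h0.bdd_mul (c := C) (f := fun z => r (x - x' - z.2)) ?_
      (Eventually.of_forall fun z => hrC _)).congr (Eventually.of_forall fun z => ?_)
    · exact (hr.comp (by fun_prop)).aestronglyMeasurable
    · simp only
      ring
  calc ∫ ω, randomConv m ξ t x ω * randomConv m ξ t' x' ω ∂P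
      = ∫ y', ∫ s, r (x - x' - s) * (fundSol m t (s + y') * fundSol m t' y') := by
        rw [h1]
        congr 1
        funext y'
        rw [← integral_add_right_eq_self _ y', ← integral_mul_const]
        congr 1
        funext s
        rw [← hr_even]
        ring_nf
    _ = ∫ s, ∫ y', r (x - x' - s) * (fundSol m t (s + y') * fundSol m t' y') :=
        integral_integral_swap hint
    _ = _ := by
        congr 1
        funext s
        rw [integral_const_mul, integral_fundSol_mul_fundSol hm hm0 ht ht']

theorem initialCov_neg (x : ℝ) : initialCov A w κ (-x) = initialCov A w κ x := by
  simp [initialCov]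

theorem measurable_solution (hη : Measurable (Function.uncurry η)) (m : ℕ) (t x : ℝ) :
    Measurable (solution m η t x) := by
  have h1 : Measurable fun z : Ω × ℝ => η (x - z.2) z.1 :=
    hη.comp ((measurable_const.sub measurable_snd).prodMk measurable_fst)
  have h2 := measurable_fundSol m t
  exact (StronglyMeasurable.integral_prod_right' (f := fun z : Ω × ℝ => η (x - z.2) z.1 *
    fundSol m t z.2) (Measurable.stronglyMeasurable (by fun_prop))).measurable

/-- The integral splits only where the centred path is integrable against the kernel, which Fubini
guarantees for almost every ω. -/
theorem solution_ae_eq (h : IsStationaryGaussian P (fun x ω => η x ω - M x) r) (hm : Even m)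
    (hm0 : 0 < m) {t : ℝ} (ht : 0 < t) (x : ℝ)
    (hMi : Integrable fun y => M (x - y) * fundSol m t y) :
    ∀ᵐ ω ∂P, solution m η t x ω =
      randomConv m (fun x ω => η x ω - M x) t x ω + ∫ y, M (x - y) * fundSol m t y := by
  have i1 := integrable_uncurry_mul (h.measurable_comp x) (fun _ => h.memLp _)
    (fun _ => h.integral_sq _) (integrable_fundSol hm hm0 ht) (measurable_fundSol m t)
  filter_upwards [i1.prod_left_ae] with ω hω
  rw [solution, randomConv, ← integral_add hω hMi]
  congr 1
  funext y
  ring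

theorem rescaledSolution_ae_eq (h : IsStationaryGaussian P (fun x ω => η x ω - M x) r)
    (hm : Even m) (hm0 : 0 < m)
    (hMi : ∀ t x : ℝ, 0 < t → Integrable fun y => M (x - y) * fundSol m t y) (q : ℝ) {ε t : ℝ}
    (hε : 0 < ε) (ht : 0 < t) (x : ℝ) :
    rescaledSolution P m q η ε t x =ᵐ[P] fun ω => ε ^ (-q / 4) *
      randomConv m (fun x ω => η x ω - M x) (t / √(ε ^ m)) (x / √ε) ω := by
  have ht' : 0 < t / √(ε ^ m) := by positivity
  have h1 := solution_ae_eq h hm hm0 ht' (x / √ε) (hMi _ _ ht')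
  have h2 : ∫ ω, solution m η (t / √(ε ^ m)) (x / √ε) ω ∂P =
      ∫ y, M (x / √ε - y) * fundSol m (t / √(ε ^ m)) y := by
    rw [integral_congr_ae h1, integral_add
      ((h.memLp_randomConv hm hm0 ht' _).integrable (by norm_num)) (integrable_const _),
      h.integral_randomConv hm hm0 ht']
    simp
  filter_upwards [h1] with ω hω
  rw [rescaledSolution, h2, hω, add_sub_cancel_right]

end RandomInitialCondition


/-! ### Stochastic integrals against a symmetric white noise -/

section WhiteNoise

open scoped ComplexConjugate

variable {Ω : Type*} {W : Set ℝ → Ω → ℂ}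

/-- The nonzero values of a simple function. -/
def nonzeroRange (s : SimpleFunc ℝ ℂ) : Finset ℂ := s.range.filter (· ≠ 0)

/-- For s in L² the fibre over 0 has infinite measure, where W is unconstrained; its coefficient 0
removes it. -/
theorem simpleIntegral_eq (s : SimpleFunc ℝ ℂ) (ω : Ω) :
    simpleIntegral W s ω = ∑ c ∈ nonzeroRange s, c * W (s ⁻¹' {c}) ω := by
  rw [simpleIntegral, nonzeroRange, Finset.sum_filter]
  refine Finset.sum_congr rfl fun c _ => ?_
  split_ifs with h
  · rfl
  · simp [not_not.1 h]

theorem measure_preimage_lt_top {s : SimpleFunc ℝ ℂ} (hs : MemLp s 2 volume) {c : ℂ}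
    (hc : c ∈ nonzeroRange s) : volume (s ⁻¹' {c}) < ⊤ :=
  s.measure_preimage_lt_top_of_memLp (by norm_num) (by norm_num) hs c (Finset.mem_filter.1 hc).2

theorem simpleFunc_eq_sum_indicator (s : SimpleFunc ℝ ℂ) (l : ℝ) :
    s l = ∑ c ∈ nonzeroRange s, (s ⁻¹' {c}).indicator (fun _ => c) l := by
  classical
  have h : ∀ c ∈ nonzeroRange s, (s ⁻¹' {c}).indicator (fun _ => c) l = if c = s l then s l else 0 := by
    intro c _
    by_cases h : c = s l
    · simp [Set.indicator, h]
    · simp [Set.indicator, h, Ne.symm h]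
  rw [Finset.sum_congr rfl h, Finset.sum_ite_eq']
  split_ifs with h1
  · rfl
  · by_contra h2
    exact h1 (Finset.mem_filter.2 ⟨s.mem_range_self l, h2⟩)

variable [MeasurableSpace Ω] {P : Measure Ω}

theorem IsSymmetricWhiteNoise.memLp_simpleIntegral (hW : IsSymmetricWhiteNoise P W)
    {s : SimpleFunc ℝ ℂ} (hs : MemLp s 2 volume) : MemLp (simpleIntegral W s) 2 P := by
  rw [funext (simpleIntegral_eq (W := W) s)]
  exact memLp_finsetSum _ fun c hc =>
    (hW.memLp _ (s.measurableSet_fiber c) (measure_preimage_lt_top hs hc)).const_mul c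

theorem IsSymmetricWhiteNoise.integral_simpleIntegral_mul_conj (hW : IsSymmetricWhiteNoise P W)
    {s s' : SimpleFunc ℝ ℂ} (hs : MemLp s 2 volume) (hs' : MemLp s' 2 volume) :
    ∫ ω, simpleIntegral W s ω * conj (simpleIntegral W s' ω) ∂P = ∫ l, s l * conj (s' l) := by
  have hfin (c : ℂ) (hc : c ∈ nonzeroRange s) := measure_preimage_lt_top hs hc
  have hfin' (c : ℂ) (hc : c ∈ nonzeroRange s') := measure_preimage_lt_top hs' hc
  have e1 : ∀ ω, simpleIntegral W s ω * conj (simpleIntegral W s' ω) =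
      ∑ c ∈ nonzeroRange s, ∑ c' ∈ nonzeroRange s',
        c * conj c' * (W (s ⁻¹' {c}) ω * conj (W (s' ⁻¹' {c'}) ω)) := by
    intro ω
    rw [simpleIntegral_eq, simpleIntegral_eq, map_sum, Finset.sum_mul_sum]
    refine Finset.sum_congr rfl fun c _ => Finset.sum_congr rfl fun c' _ => ?_
    rw [map_mul]; ring
  have e2 : ∀ l, s l * conj (s' l) = ∑ c ∈ nonzeroRange s, ∑ c' ∈ nonzeroRange s',
      (s ⁻¹' {c} ∩ s' ⁻¹' {c'}).indicator (fun _ => c * conj c') l := by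
    intro l
    rw [simpleFunc_eq_sum_indicator s l, simpleFunc_eq_sum_indicator s' l, map_sum,
      Finset.sum_mul_sum]
    refine Finset.sum_congr rfl fun c _ => Finset.sum_congr rfl fun c' _ => ?_
    by_cases h : s l = c <;> by_cases h' : s' l = c' <;> simp [Set.indicator, h, h']
  simp only [e1, e2]
  have i1 : ∀ c ∈ nonzeroRange s, ∀ c' ∈ nonzeroRange s', Integrable (fun ω =>
      c * conj c' * (W (s ⁻¹' {c}) ω * conj (W (s' ⁻¹' {c'}) ω))) P := fun c hc c' hc' =>
    ((hW.memLp _ (s.measurableSet_fiber c) (hfin c hc)).integrable_mul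
      (hW.memLp _ (s'.measurableSet_fiber c') (hfin' c' hc')).star).const_mul _
  have i2 : ∀ c ∈ nonzeroRange s, ∀ c' ∈ nonzeroRange s', Integrable
      ((s ⁻¹' {c} ∩ s' ⁻¹' {c'}).indicator fun _ => c * conj c') := fun c hc c' _ =>
    (integrable_indicator_iff ((s.measurableSet_fiber c).inter (s'.measurableSet_fiber c'))).2
      (integrableOn_const (measure_ne_top_of_subset Set.inter_subset_left (hfin c hc).ne)
        )
  rw [integral_finsetSum _ fun c hc => integrable_finsetSum _ fun c' hc' => i1 c hc c' hc',
    integral_finsetSum _ fun c hc => integrable_finsetSum _ fun c' hc' => i2 c hc c' hc']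
  refine Finset.sum_congr rfl fun c hc => ?_
  rw [integral_finsetSum _ (i1 c hc), integral_finsetSum _ (i2 c hc)]
  refine Finset.sum_congr rfl fun c' hc' => ?_
  rw [integral_const_mul, hW.covariance _ _ (s.measurableSet_fiber c) (hfin c hc)
    (s'.measurableSet_fiber c') (hfin' c' hc'),
    integral_indicator ((s.measurableSet_fiber c).inter (s'.measurableSet_fiber c')),
    setIntegral_const, Complex.real_smul, mul_comm]

theorem inner_toLp {α : Type*} [MeasurableSpace α] {μ : Measure α} {f g : α → ℂ}
    (hf : MemLp f 2 μ) (hg : MemLp g 2 μ) :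
    inner ℂ hf.toLp hg.toLp = ∫ a, g a * conj (f a) ∂μ := by
  rw [L2.inner_def]
  refine integral_congr_ae ?_
  filter_upwards [hf.coeFn_toLp, hg.coeFn_toLp] with a e1 e2
  rw [e1, e2, RCLike.inner_apply]

theorem IsSymmetricWhiteNoise.inner_simpleIntegral (hW : IsSymmetricWhiteNoise P W)
    {s s' : SimpleFunc ℝ ℂ} (hs : MemLp s 2 volume) (hs' : MemLp s' 2 volume) :
    inner ℂ (hW.memLp_simpleIntegral hs).toLp (hW.memLp_simpleIntegral hs').toLp =
      inner ℂ hs.toLp hs'.toLp := by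
  rw [inner_toLp, inner_toLp, hW.integral_simpleIntegral_mul_conj hs' hs]

theorem IsSymmetricWhiteNoise.norm_simpleIntegral_sub (hW : IsSymmetricWhiteNoise P W)
    {s s' : SimpleFunc ℝ ℂ} (hs : MemLp s 2 volume) (hs' : MemLp s' 2 volume) :
    ‖(hW.memLp_simpleIntegral hs).toLp - (hW.memLp_simpleIntegral hs').toLp‖ =
      ‖hs.toLp - hs'.toLp‖ := by
  rw [← sq_eq_sq₀ (norm_nonneg _) (norm_nonneg _), norm_sub_sq (𝕜 := ℂ), norm_sub_sq (𝕜 := ℂ),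
    norm_sq_eq_re_inner (𝕜 := ℂ), norm_sq_eq_re_inner (𝕜 := ℂ), norm_sq_eq_re_inner (𝕜 := ℂ),
    norm_sq_eq_re_inner (𝕜 := ℂ), hW.inner_simpleIntegral, hW.inner_simpleIntegral,
    hW.inner_simpleIntegral]

theorem tendsto_toLp_iff {α : Type*} [MeasurableSpace α] {μ : Measure α} {f : ℕ → α → ℂ}
    {g : α → ℂ} (hf : ∀ k, MemLp (f k) 2 μ) (hg : MemLp g 2 μ) :
    Tendsto (fun k => eLpNorm (fun a => g a - f k a) 2 μ) atTop (𝓝 0) ↔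
      Tendsto (fun k => (hf k).toLp) atTop (𝓝 hg.toLp) := by
  rw [Lp.tendsto_Lp_iff_tendsto_eLpNorm'']
  refine tendsto_congr fun k => ?_
  rw [← eLpNorm_neg]
  congr 1
  funext a
  simp

/-- The isometry on simple functions carries Cauchy sequences to Cauchy sequences, and L²(Ω) is
complete. -/
theorem IsSymmetricWhiteNoise.exists_hasStochasticIntegral (hW : IsSymmetricWhiteNoise P W)
    {h : ℝ → ℂ} (hh : MemLp h 2 volume) : ∃ X, HasStochasticIntegral P W h X := by
  have hex (k : ℕ) := hh.exists_simpleFunc_eLpNorm_sub_lt (by norm_num)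
    (ε := ((k : ENNReal) + 1)⁻¹) (by simp)
  choose s hs hs2 using hex
  have hlim : Tendsto (fun k => eLpNorm (fun l => h l - s k l) 2 volume) atTop (𝓝 0) := by
    refine tendsto_of_tendsto_of_tendsto_of_le_of_le tendsto_const_nhds
      (h := fun k : ℕ => ((k : ENNReal) + 1)⁻¹) ?_ (fun _ => zero_le) fun k => (hs k).le
    have := (tendsto_add_atTop_iff_nat 1).2 ENNReal.tendsto_inv_nat_nhds_zero
    simpa using this
  have hc : CauchySeq fun k => (hs2 k).toLp := ((tendsto_toLp_iff hs2 hh).1 hlim).cauchySeq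
  have hc' : CauchySeq fun k => (hW.memLp_simpleIntegral (hs2 k)).toLp := by
    rw [Metric.cauchySeq_iff] at hc ⊢
    intro ε hε
    obtain ⟨N, hN⟩ := hc ε hε
    refine ⟨N, fun i hi j hj => ?_⟩
    have := hN i hi j hj
    rwa [dist_eq_norm, hW.norm_simpleIntegral_sub, ← dist_eq_norm]
  obtain ⟨X, hX⟩ := cauchySeq_tendsto_of_complete hc'
  refine ⟨X, hh, Lp.memLp X, s, hs2, hlim, ?_⟩
  refine (tendsto_toLp_iff (fun k => hW.memLp_simpleIntegral (hs2 k)) (Lp.memLp X)).2 ?_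
  rwa [Lp.toLp_coeFn]

/-- The isometry passes to the limit along any approximating sequences, so it holds for all versions
of the integrals. -/
theorem IsSymmetricWhiteNoise.integral_mul_conj (hW : IsSymmetricWhiteNoise P W)
    {h h' : ℝ → ℂ} {X X' : Ω → ℂ} (hX : HasStochasticIntegral P W h X)
    (hX' : HasStochasticIntegral P W h' X') :
    ∫ ω, X ω * conj (X' ω) ∂P = ∫ l, h l * conj (h' l) := by
  obtain ⟨hh, hX2, s, hs, hs1, hs2⟩ := hX
  obtain ⟨hh', hX2', s', hs', hs1', hs2'⟩ := hX'
  rw [← inner_toLp hX2' hX2, ← inner_toLp hh' hh]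
  have t1 := (tendsto_toLp_iff hs hh).1 hs1
  have t1' := (tendsto_toLp_iff hs' hh').1 hs1'
  have t2 := (tendsto_toLp_iff (fun k => hW.memLp_simpleIntegral (hs k)) hX2).1 hs2
  have t2' := (tendsto_toLp_iff (fun k => hW.memLp_simpleIntegral (hs' k)) hX2').1 hs2'
  exact tendsto_nhds_unique (t2'.inner t2)
    ((t1'.inner t1).congr fun k => (hW.inner_simpleIntegral (hs' k) (hs k)).symm)

/-- The reflection `l ↦ conj (s (-l))` of a simple function. -/
def reflect (s : SimpleFunc ℝ ℂ) : SimpleFunc ℝ ℂ := (s.map conj).comp Neg.neg measurable_neg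

theorem reflect_apply (s : SimpleFunc ℝ ℂ) (l : ℝ) : reflect s l = conj (s (-l)) := rfl

theorem memLp_reflect {f : ℝ → ℂ} (hf : MemLp f 2 volume) :
    MemLp (fun l => conj (f (-l))) 2 volume :=
  (hf.comp_measurePreserving (Measure.measurePreserving_neg volume)).star

/-- The fibre of `reflect s` over conj c is the reflection of the fibre of s over c, where the
symmetry of W applies. -/
theorem IsSymmetricWhiteNoise.conj_simpleIntegral (hW : IsSymmetricWhiteNoise P W)
    {s : SimpleFunc ℝ ℂ} (hs : MemLp s 2 volume) :
    ∀ᵐ ω ∂P, conj (simpleIntegral W s ω) = simpleIntegral W (reflect s) ω := by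
  have h : ∀ᵐ ω ∂P, ∀ c ∈ nonzeroRange s,
      W {x | -x ∈ s ⁻¹' {c}} ω = conj (W (s ⁻¹' {c}) ω) :=
    (Finset.eventually_all _).2 fun c hc =>
      hW.symmetric _ (s.measurableSet_fiber c) (measure_preimage_lt_top hs hc)
  filter_upwards [h] with ω hω
  rw [simpleIntegral_eq, simpleIntegral_eq, map_sum]
  refine Finset.sum_bij' (fun c _ => conj c) (fun c _ => conj c) ?_ ?_ ?_ ?_ ?_
  · intro c hc
    simp only [nonzeroRange, Finset.mem_filter, SimpleFunc.mem_range, Set.mem_range] at hc ⊢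
    obtain ⟨⟨l, hl⟩, h0⟩ := hc
    exact ⟨⟨-l, by rw [reflect_apply, neg_neg, hl]⟩, by simpa using h0⟩
  · intro c hc
    simp only [nonzeroRange, Finset.mem_filter, SimpleFunc.mem_range, Set.mem_range] at hc ⊢
    obtain ⟨⟨l, hl⟩, h0⟩ := hc
    exact ⟨⟨-l, by rw [← hl, reflect_apply, Complex.conj_conj]⟩, by simpa using h0⟩
  · intro c _; simp
  · intro c _; simp
  · intro c hc
    rw [map_mul, ← hω c hc]
    congr 3
    ext l
    simp only [Set.mem_preimage, Set.mem_singleton_iff, reflect_apply]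
    exact (starRingEnd ℂ).injective.eq_iff.symm

/-- Conjugating X gives an integral of the reflected kernel, which is h again; by the isometry two
integrals of one kernel are at distance 0. This makes the limit field real. -/
theorem IsSymmetricWhiteNoise.conj_ae_eq (hW : IsSymmetricWhiteNoise P W)
    {h : ℝ → ℂ} {X : Ω → ℂ} (hX : HasStochasticIntegral P W h X)
    (hsymm : ∀ l, conj (h (-l)) = h l) : ∀ᵐ ω ∂P, conj (X ω) = X ω := by
  obtain ⟨hh, hX2, s, hs, hs1, hs2⟩ := hX
  have hsr (k : ℕ) : MemLp (reflect (s k)) 2 volume := memLp_reflect (hs k)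
  have hr1 : Tendsto (fun k => eLpNorm (fun l => h l - reflect (s k) l) 2 volume) atTop (𝓝 0) := by
    refine hs1.congr fun k => ?_
    have e : (fun l => h l - reflect (s k) l) =
        (fun l => conj (h l - s k l)) ∘ Neg.neg := by
      funext l
      rw [Function.comp_apply, map_sub, hsymm, reflect_apply]
    have hc : AEStronglyMeasurable (fun l => conj (h l - s k l)) volume := (hh.sub (hs k)).star.1
    rw [e, eLpNorm_comp_measurePreserving hc (Measure.measurePreserving_neg volume)]
    refine eLpNorm_congr_norm_ae (Eventually.of_forall fun l => ?_)
    exact (RCLike.norm_conj _).symm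
  have hc2 : Tendsto (fun k => eLpNorm (fun ω => conj (X ω) - simpleIntegral W (reflect (s k)) ω)
      2 P) atTop (𝓝 0) := by
    refine hs2.congr fun k => ?_
    refine eLpNorm_congr_norm_ae ?_
    filter_upwards [hW.conj_simpleIntegral (hs k)] with ω hω
    rw [← hω, ← map_sub, RCLike.norm_conj]
  have hXc : MemLp (fun ω => conj (X ω)) 2 P := hX2.star
  have hXc' : HasStochasticIntegral P W h fun ω => conj (X ω) :=
    ⟨hh, hXc, fun k => reflect (s k), hsr, hr1, hc2⟩
  have hX' : HasStochasticIntegral P W h X := ⟨hh, hX2, s, hs, hs1, hs2⟩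
  have e : ‖hXc.toLp - hX2.toLp‖ ^ 2 = 0 := by
    rw [norm_sub_sq (𝕜 := ℂ), norm_sq_eq_re_inner (𝕜 := ℂ), norm_sq_eq_re_inner (𝕜 := ℂ),
      inner_toLp, inner_toLp, inner_toLp, hW.integral_mul_conj hXc' hXc',
      hW.integral_mul_conj hX' hXc', hW.integral_mul_conj hX' hX']
    ring
  have e2 : hXc.toLp = hX2.toLp := by
    rw [← sub_eq_zero, ← norm_eq_zero]
    exact pow_eq_zero_iff (two_ne_zero) |>.1 e
  exact (MemLp.toLp_eq_toLp_iff hXc hX2).1 e2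

/-- The real parts of the multiples of the values of the noise. -/
def noiseFamily (W : Set ℝ → Ω → ℂ) (p : {A : Set ℝ // MeasurableSet A ∧ volume A < ⊤} × ℂ)
    (ω : Ω) : ℝ := (p.2 * W p.1.1 ω).re

theorem IsSymmetricWhiteNoise.isGaussianProcess_noiseFamily (hW : IsSymmetricWhiteNoise P W) :
    IsGaussianProcess (noiseFamily W) P :=
  (hW.gaussian.comp_right Prod.fst).comp_left
    (fun p : {A : Set ℝ // MeasurableSet A ∧ volume A < ⊤} × ℂ =>
      Complex.reCLM.comp (ContinuousLinearMap.mul ℝ ℂ p.2))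

theorem IsSymmetricWhiteNoise.memLp_noiseFamily (hW : IsSymmetricWhiteNoise P W)
    (p : {A : Set ℝ // MeasurableSet A ∧ volume A < ⊤} × ℂ) : MemLp (noiseFamily W p) 2 P :=
  ((hW.memLp _ p.1.2.1 p.1.2.2).const_mul p.2).re

theorem IsSymmetricWhiteNoise.integral_noiseFamily (hW : IsSymmetricWhiteNoise P W)
    (p : {A : Set ℝ // MeasurableSet A ∧ volume A < ⊤} × ℂ) : ∫ ω, noiseFamily W p ω ∂P = 0 := by
  have := hW.gaussian.isProbabilityMeasure
  have hi : Integrable (fun ω => p.2 * W p.1.1 ω) P :=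
    ((hW.memLp _ p.1.2.1 p.1.2.2).integrable (by norm_num)).const_mul p.2
  have h := integral_re hi
  rw [integral_const_mul, hW.mean_zero _ p.1.2.1 p.1.2.2, mul_zero, map_zero] at h
  exact h

theorem IsSymmetricWhiteNoise.hasGaussianCharFun (hW : IsSymmetricWhiteNoise P W) :
    ∀ U ∈ gaussianSpace hW.memLp_noiseFamily, HasGaussianCharFun U :=
  fun _ hU => hasGaussianCharFun_of_mem hW.isGaussianProcess_noiseFamily hW.memLp_noiseFamily
    hW.integral_noiseFamily hU

/-- `noiseFamily` carries the complex coefficients, so the real part of a simple integral is a sum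
of its members with weights 1; the general case is an L² limit. -/
theorem IsSymmetricWhiteNoise.toLp_re_mem (hW : IsSymmetricWhiteNoise P W)
    {h : ℝ → ℂ} {X : Ω → ℂ} (hX : HasStochasticIntegral P W h X)
    (hR : MemLp (fun ω => (X ω).re) 2 P) : hR.toLp ∈ gaussianSpace hW.memLp_noiseFamily := by
  obtain ⟨hh, hX2, s, hs, hs1, hs2⟩ := hX
  have hI (k : ℕ) : MemLp (fun ω => (simpleIntegral W (s k) ω).re) 2 P :=
    (hW.memLp_simpleIntegral (hs k)).re
  have hlim : Tendsto (fun k => (hI k).toLp) atTop (𝓝 hR.toLp) := by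
    rw [Lp.tendsto_Lp_iff_tendsto_eLpNorm'']
    refine tendsto_of_tendsto_of_tendsto_of_le_of_le tendsto_const_nhds hs2
      (fun _ => zero_le) fun k => eLpNorm_mono fun ω => ?_
    rw [Pi.sub_apply, ← Complex.sub_re, norm_sub_rev, Real.norm_eq_abs]
    exact Complex.abs_re_le_norm _
  refine mem_closure_of_tendsto hlim (Eventually.of_forall fun k => ?_)
  have hmem := toLp_sum_mem (ι := nonzeroRange (s k))
    (K := Submodule.span ℝ (Set.range fun p => (hW.memLp_noiseFamily p).toLp))
    (X := fun c => noiseFamily W (⟨s k ⁻¹' {c.1}, (s k).measurableSet_fiber c.1,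
      measure_preimage_lt_top (hs k) c.2⟩, c.1))
    (fun c => hW.memLp_noiseFamily _) (fun c => Submodule.subset_span ⟨_, rfl⟩) 1
  obtain ⟨h1, h2⟩ := hmem
  have e : (fun ω => (simpleIntegral W (s k) ω).re) = fun ω => ∑ c : nonzeroRange (s k),
      (1 : nonzeroRange (s k) → ℝ) c * noiseFamily W (⟨s k ⁻¹' {c.1},
        (s k).measurableSet_fiber c.1, measure_preimage_lt_top (hs k) c.2⟩, c.1) ω := by
    funext ω
    rw [simpleIntegral_eq, Complex.re_sum, ← Finset.sum_coe_sort]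
    simp [noiseFamily]
  have e2 : (hI k).toLp = h1.toLp := by
    congr 1
  rw [e2]
  exact h2

end WhiteNoise


/-! ### The kernel of the limit field -/

section LimitKernel

open scoped ComplexConjugate

variable {m : ℕ} {κ : ℝ}

theorem conj_limitKernel_neg (hm : Even m) (t x l : ℝ) :
    conj (limitKernel m κ t x (-l)) = limitKernel m κ t x l := by
  rw [limitKernel, limitKernel, map_div₀, Complex.conj_ofReal, abs_neg, ← Complex.exp_conj]
  simp [hm.neg_pow]

theorem limitKernel_mul_conj (hκ : κ ∈ Set.Ioo (0 : ℝ) 1) (t t' x x' l : ℝ) :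
    limitKernel m κ t x l * conj (limitKernel m κ t' x' l) =
      ((|l| ^ (κ - 1) * Real.exp (-(t + t') * l ^ m) : ℝ) : ℂ) *
        Complex.exp ((l * (x - x') : ℝ) * Complex.I) := by
  have h1 : (|l| ^ ((1 - κ) / 2) * |l| ^ ((1 - κ) / 2))⁻¹ = |l| ^ (κ - 1) := by
    -- At l = 0 both sides are 0, by the conventions for 0 raised to a nonzero power and for the
    -- inverse of 0.
    rcases eq_or_ne l 0 with rfl | hl
    · have e1 : (1 - κ) / 2 ≠ 0 := by linarith [hκ.2]
      have e2 : κ - 1 ≠ 0 := by linarith [hκ.2]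
      simp [Real.zero_rpow e1, Real.zero_rpow e2]
    · have hl' : 0 < |l| := abs_pos.2 hl
      rw [← Real.rpow_add hl', ← Real.rpow_neg hl'.le]
      ring_nf
  rw [limitKernel, limitKernel, map_div₀, Complex.conj_ofReal, ← Complex.exp_conj,
    div_mul_div_comm, ← Complex.ofReal_mul, div_eq_inv_mul, ← Complex.ofReal_inv, h1,
    Complex.ofReal_mul, mul_assoc (_ : ℂ) (Complex.ofReal _) (Complex.exp _), ← Complex.exp_add,
    Complex.ofReal_exp, ← Complex.exp_add]
  congr 2
  simp only [map_sub, map_mul, map_pow, Complex.conj_ofReal, Complex.conj_I]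
  push_cast
  ring

theorem measurable_limitKernel (t x : ℝ) : Measurable (limitKernel m κ t x) := by
  unfold limitKernel
  fun_prop

theorem memLp_limitKernel (hm : Even m) (hm0 : 0 < m) (hκ : κ ∈ Set.Ioo (0 : ℝ) 1) {t : ℝ}
    (ht : 0 < t) (x : ℝ) : MemLp (limitKernel m κ t x) 2 volume := by
  refine (memLp_two_iff_integrable_sq_norm
    (measurable_limitKernel t x).aestronglyMeasurable).2 ?_
  refine (integrable_abs_rpow_mul_exp hm hm0 (add_pos ht ht) (q := κ - 1)
    (by linarith [hκ.1])).congr (Eventually.of_forall fun l => ?_)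
  have h := limitKernel_mul_conj (m := m) hκ t t x x l
  rw [sub_self, mul_zero, Complex.ofReal_zero, zero_mul, Complex.exp_zero, mul_one,
    Complex.mul_conj, Complex.normSq_eq_norm_sq] at h
  exact (Complex.ofReal_injective h).symm

theorem re_integral_limitKernel_mul_conj (hm : Even m) (hm0 : 0 < m)
    (hκ : κ ∈ Set.Ioo (0 : ℝ) 1) {t t' : ℝ} (ht : 0 < t) (ht' : 0 < t') (x x' : ℝ) :
    (∫ l, limitKernel m κ t x l * conj (limitKernel m κ t' x' l)).re =
      ∫ l : ℝ, |l| ^ (κ - 1) * Real.cos (l * (x - x')) * Real.exp (-(t + t') * l ^ m) := by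
  have hi : Integrable fun l => limitKernel m κ t x l * conj (limitKernel m κ t' x' l) :=
    (memLp_limitKernel hm hm0 hκ ht x).integrable_mul (memLp_limitKernel hm hm0 hκ ht' x').star
  rw [← RCLike.re_eq_complex_re, ← integral_re hi]
  congr 1
  funext l
  rw [limitKernel_mul_conj hκ, RCLike.re_eq_complex_re, Complex.re_ofReal_mul,
    Complex.exp_ofReal_mul_I_re]
  ring

theorem integral_limitCov_zero_pos (hm : Even m) (hm0 : 0 < m) (hκ : 0 < κ) {T : ℝ} (hT : 0 < T) :
    0 < ∫ l : ℝ, |l| ^ (κ - 1) * Real.cos (l * 0) * Real.exp (-T * l ^ m) := by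
  simp only [mul_zero, Real.cos_zero, mul_one]
  rw [integral_abs_rpow_mul_exp hm hm0 hT (by linarith)]
  have hm' : (0 : ℝ) < m := Nat.cast_pos.2 hm0
  have := Real.Gamma_pos_of_pos (s := (κ - 1 + 1) / m) (div_pos (by linarith) hm')
  positivity

end LimitKernel

/-! ### Construction of the limit field -/

section LimitField

open scoped ComplexConjugate

variable {Ω : Type*} [MeasurableSpace Ω] {P : Measure Ω} [IsProbabilityMeasure P]
  {W : Set ℝ → Ω → ℂ} {m : ℕ} {κ : ℝ}

/-- The limit field, up to a constant. -/
theorem IsSymmetricWhiteNoise.exists_field (hW : IsSymmetricWhiteNoise P W) (hm : Even m)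
    (hm0 : 0 < m) (hκ : κ ∈ Set.Ioo (0 : ℝ) 1) (a : ℝ) :
    ∃ U₀ : Set.Ioi (0 : ℝ) × ℝ → Ω → ℝ,
      (∀ p, ∃ X : Ω → ℂ, HasStochasticIntegral P W (limitKernel m κ p.1 p.2) X ∧
        ∀ᵐ ω ∂P, (U₀ p ω : ℂ) = (a : ℂ) * X ω) ∧
      IsGaussianProcess U₀ P ∧ (∀ p, ∫ ω, U₀ p ω ∂P = 0) ∧
      ∀ p q, cov[U₀ p, U₀ q; P] = a ^ 2 * ∫ l : ℝ, |l| ^ (κ - 1) *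
        Real.cos (l * (p.2 - q.2)) * Real.exp (-((p.1 : ℝ) + q.1) * l ^ m) := by
  choose X hX using fun p : Set.Ioi (0 : ℝ) × ℝ =>
    hW.exists_hasStochasticIntegral (memLp_limitKernel hm hm0 hκ p.1.2 p.2)
  have hreal (p) : ∀ᵐ ω ∂P, ((X p ω).re : ℂ) = X p ω := by
    filter_upwards [hW.conj_ae_eq (hX p) (conj_limitKernel_neg hm _ _)] with ω hω
    exact Complex.conj_eq_iff_re.1 hω
  have hR (p) : MemLp (fun ω => (X p ω).re) 2 P := (hX p).2.1.re
  have hRmem (p) : (hR p).toLp ∈ gaussianSpace hW.memLp_noiseFamily := hW.toLp_re_mem (hX p) (hR p)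
  have hmean (p) : ∫ ω, (X p ω).re ∂P = 0 :=
    integral_eq_zero_of_submodule hW.hasGaussianCharFun (hR p) (hRmem p)
  refine ⟨fun p ω => a * (X p ω).re, fun p => ⟨X p, hX p, ?_⟩, ?_, fun p => ?_, fun p q => ?_⟩
  · filter_upwards [hreal p] with ω hω
    rw [Complex.ofReal_mul, hω]
  · exact (isGaussianProcess_of_submodule hW.hasGaussianCharFun hR hRmem).smul fun _ => a
  · rw [integral_const_mul, hmean, mul_zero]
  · rw [covariance_const_mul_left, covariance_const_mul_right, ← mul_assoc, ← sq,
      ProbabilityTheory.covariance,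
      hmean, hmean, ← re_integral_limitKernel_mul_conj hm hm0 hκ p.1.2 q.1.2,
      ← hW.integral_mul_conj (hX p) (hX q)]
    have e : ∫ ω, X p ω * conj (X q ω) ∂P = ((∫ ω, (X p ω).re * (X q ω).re ∂P : ℝ) : ℂ) := by
      rw [← integral_complex_ofReal]
      refine integral_congr_ae ?_
      filter_upwards [hreal p, hreal q] with ω e1 e2
      rw [← e1, ← e2]
      simp
    rw [e, Complex.ofReal_re]
    simp

end LimitField

/-! ### Assembly of the theorem -/

section Main

theorem hasGaussianLaw_pi {Ω ι : Type*} [Fintype ι] [MeasurableSpace Ω] {P : Measure Ω}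
    {X : ι → Ω → ℝ} (hX : IsGaussianProcess X P) : HasGaussianLaw (fun ω i => X i ω) P :=
  (hX.hasGaussianLaw Finset.univ).map_fun
    (.pi fun i => .proj (R := ℝ) (⟨i, Finset.mem_univ i⟩ : (Finset.univ : Finset ι)))

variable {Ω : Type*} [MeasurableSpace Ω] {P : Measure Ω} [IsProbabilityMeasure P]
  {m : ℕ} {n : ℕ} {A w κ : Fin (n + 1) → ℝ} {ξ : ℝ → Ω → ℝ}

theorem IsStationaryGaussian.tendsto_covariance
    (h : IsStationaryGaussian P ξ (initialCov A w κ)) (hm : Even m)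
    (hm0 : 0 < m) (hw0 : w 0 = 0) (hw : ∀ j, j ≠ 0 → w j ≠ 0)
    (hκ : ∀ j, κ j ∈ Set.Ioo (0 : ℝ) 1) {t t' : ℝ} (ht : 0 < t) (ht' : 0 < t') (x x' : ℝ) :
    Tendsto (fun ε : ℝ => ε ^ (-κ 0 / 2) *
        ∫ ω, randomConv m ξ (t / √(ε ^ m)) (x / √ε) ω *
          randomConv m ξ (t' / √(ε ^ m)) (x' / √ε) ω ∂P) (𝓝[>] 0)
      (𝓝 (A 0 * c₂ (κ 0) * ∫ l : ℝ, |l| ^ (κ 0 - 1) * Real.cos (l * (x - x')) *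
        Real.exp (-(t + t') * l ^ m))) := by
  refine (tendsto_rescaled_covariance hm hm0 (add_pos ht ht') hw0 hw hκ (x - x')).congr' ?_
  filter_upwards [self_mem_nhdsWithin] with ε hε
  have hε' : 0 < ε := hε
  rw [h.integral_randomConv_mul continuous_initialCov (abs_initialCov_le hκ) initialCov_neg hm hm0
    (by positivity) (by positivity), sub_div, add_div]

/-- The rescaled variances at t = 1, x = 0 are nonnegative and tend to this coefficient times a
positive integral. Hence √(A₀c₂(κ₀)) squares back to A₀c₂(κ₀), although A₀ is only assumed nonzero.
-/
theorem IsStationaryGaussian.coeff_nonneg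
    (h : IsStationaryGaussian P ξ (initialCov A w κ)) (hm : Even m)
    (hm0 : 0 < m) (hw0 : w 0 = 0) (hw : ∀ j, j ≠ 0 → w j ≠ 0)
    (hκ : ∀ j, κ j ∈ Set.Ioo (0 : ℝ) 1) : 0 ≤ A 0 * c₂ (κ 0) := by
  have hlim := h.tendsto_covariance hm hm0 hw0 hw hκ one_pos one_pos 0 0
  rw [sub_self] at hlim
  have hpos := integral_limitCov_zero_pos hm hm0 (hκ 0).1 (add_pos one_pos one_pos)
  refine nonneg_of_mul_nonneg_left (ge_of_tendsto hlim ?_) hpos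
  filter_upwards [self_mem_nhdsWithin] with ε hε
  have hε' : 0 < ε := hε
  exact mul_nonneg (by positivity) (integral_nonneg fun ω => mul_self_nonneg _)

end Main

end RandomHeat

end

theorem theorem3p2
    {Ω : Type*} [MeasurableSpace Ω] (P : Measure Ω) [IsProbabilityMeasure P]
    -- the even order of the equation
    (m : ℕ) (hm : Even m) (hm0 : 0 < m)
    -- the parameters of the covariance function
    (n : ℕ) (A w κ : Fin (n + 1) → ℝ)
    (hA : ∑ j, A j = 1) (hA0 : A 0 ≠ 0)
    (hw0 : w 0 = 0) (hw : ∀ j, j ≠ 0 → w j ≠ 0)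
    (hκ : ∀ j, κ j ∈ Set.Ioo (0 : ℝ) 1)
    -- the random initial condition: a measurable Gaussian process with mean `M`, covariance `r`
    (η : ℝ → Ω → ℝ) (hη_meas : Measurable (Function.uncurry η))
    (hη_gauss : IsGaussianProcess η P)
    (M : ℝ → ℝ) (hM : ∀ x, ∫ ω, η x ω ∂P = M x)
    (hη_cov : ∀ y x, cov[η y, η (y + x); P] = RandomHeat.initialCov A w κ x)
    -- the convolution of the mean with the fundamental solution makes sense
    (hM_int : ∀ t x : ℝ, 0 < t → Integrable (fun y => M (x - y) * RandomHeat.fundSol m t y))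
    -- the white noise which defines the limit field
    {Ω' : Type*} [MeasurableSpace Ω'] (P' : Measure Ω') [IsProbabilityMeasure P']
    (W : Set ℝ → Ω' → ℂ) (hW : RandomHeat.IsSymmetricWhiteNoise P' W) :
    ∃ U₀ : Set.Ioi (0 : ℝ) × ℝ → Ω' → ℝ,
      -- `U₀(t, x) = √(A₀ c₂(κ₀)) ∫ e^{iλx - λ^m t} |λ|^{-(1-κ₀)/2} W(dλ)`
      (∀ p, ∃ X : Ω' → ℂ,
        RandomHeat.HasStochasticIntegral P' W (RandomHeat.limitKernel m (κ 0) p.1 p.2) X ∧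
        ∀ᵐ ω ∂P', (U₀ p ω : ℂ) = (√(A 0 * RandomHeat.c₂ (κ 0)) : ℂ) * X ω) ∧
      -- `U₀` is a zero-mean Gaussian field
      IsGaussianProcess U₀ P' ∧
      (∀ p, ∫ ω, U₀ p ω ∂P' = 0) ∧
      -- the two formulas for the covariance function of `U₀`
      (∀ (t t' : Set.Ioi (0 : ℝ)) (x x' : ℝ),
        Integrable (fun l : ℝ => |l| ^ (κ 0 - 1) * Real.cos (l * (x - x')) *
          Real.exp (-((t : ℝ) + t') * l ^ m)) ∧
        cov[U₀ (t, x), U₀ (t', x'); P'] =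
          A 0 * RandomHeat.c₂ (κ 0) * ∫ l : ℝ, |l| ^ (κ 0 - 1) * Real.cos (l * (x - x')) *
            Real.exp (-((t : ℝ) + t') * l ^ m) ∧
        Summable (RandomHeat.foxWrightTerm ![(κ 0 / m, 2 / (m : ℝ))] ![(1 / 2, 1)]
          (-(x - x') ^ 2 / (4 * ((t : ℝ) + t') ^ (2 / (m : ℝ))))) ∧
        cov[U₀ (t, x), U₀ (t', x'); P'] =
          2 * √Real.pi * A 0 * RandomHeat.c₂ (κ 0) / (m * ((t : ℝ) + t') ^ (κ 0 / m)) *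
            RandomHeat.foxWright ![(κ 0 / m, 2 / (m : ℝ))] ![(1 / 2, 1)]
              (-(x - x') ^ 2 / (4 * ((t : ℝ) + t') ^ (2 / (m : ℝ))))) ∧
      -- weak convergence of all finite-dimensional distributions of `U_ε`, as `ε → 0+`
      ∀ (k : ℕ) (p : Fin k → Set.Ioi (0 : ℝ) × ℝ),
        TendstoInDistribution
          (fun (ε : ℝ) (ω : Ω) (i : Fin k) =>
            RandomHeat.rescaledSolution P m (κ 0) η ε (p i).1 (p i).2 ω)
          (𝓝[>] (0 : ℝ))
          (fun (ω : Ω') (i : Fin k) => U₀ (p i) ω)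
          (fun _ => P) P' := by
  have hξ := RandomHeat.isStationaryGaussian_sub_mean hη_meas hη_gauss hM hη_cov
  have hAc := hξ.coeff_nonneg hm hm0 hw0 hw hκ
  obtain ⟨U₀, hU1, hU2, hU3, hU4⟩ := hW.exists_field hm hm0 (hκ 0) √(A 0 * RandomHeat.c₂ (κ 0))
  rw [Real.sq_sqrt hAc] at hU4
  refine ⟨U₀, hU1, hU2, hU3, fun t t' x x' => ?_, fun k p => ?_⟩
  · have hT : 0 < (t : ℝ) + t' := add_pos t.2 t'.2
    have hs := RandomHeat.hasSum_foxWrightTerm hm hm0 hT (hκ 0).1 (x - x')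
    have hm' : (0 : ℝ) < m := Nat.cast_pos.2 hm0
    have hp : 0 < √Real.pi := Real.sqrt_pos.2 Real.pi_pos
    have hTp : 0 < ((t : ℝ) + t') ^ (κ 0 / m) := by positivity
    refine ⟨RandomHeat.integrable_limitCov hm hm0 hT (hκ 0).1 (x - x'), hU4 _ _, hs.summable, ?_⟩
    rw [hU4, RandomHeat.foxWright, hs.tsum_eq]
    simp only
    generalize (∫ l : ℝ, |l| ^ (κ 0 - 1) * Real.cos (l * (x - x')) *
      Real.exp (-((t : ℝ) + t') * l ^ m)) = J
    field_simp
  · have hη1 (ε : ℝ) (i : Fin k) : Measurable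
        (RandomHeat.rescaledSolution P m (κ 0) η ε (p i).1 (p i).2) :=
      ((RandomHeat.measurable_solution hη_meas m _ _).sub_const _).const_mul _
    have hae {ε : ℝ} (hε : 0 < ε) (i : Fin k) := RandomHeat.rescaledSolution_ae_eq hξ hm hm0 hM_int
      (κ 0) hε (p i).1.2 (p i).2
    have htε {ε : ℝ} (hε : 0 < ε) (i : Fin k) : 0 < ((p i).1 : ℝ) / √(ε ^ m) :=
      div_pos (p i).1.2 (Real.sqrt_pos.2 (pow_pos hε m))
    have hmean {ε : ℝ} (hε : 0 < ε) (i : Fin k) :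
        ∫ ω, RandomHeat.rescaledSolution P m (κ 0) η ε (p i).1 (p i).2 ω ∂P = 0 := by
      rw [integral_congr_ae (hae hε i), integral_const_mul,
        hξ.integral_randomConv hm hm0 (htε hε i), mul_zero]
    refine RandomHeat.tendstoInDistribution_of_tendsto_covariance
      (X := fun ε i => RandomHeat.rescaledSolution P m (κ 0) η ε (p i).1 (p i).2)
      (Z := fun i => U₀ (p i)) (fun ε => (measurable_pi_lambda _ (hη1 ε)).aemeasurable)
      ?_ ?_ ?_ (fun i => hU3 _) fun i j => ?_
    · filter_upwards [self_mem_nhdsWithin] with ε hε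
      -- All centred solution values lie in one Gaussian space, so they are jointly Gaussian; the
      -- normalization is a linear map.
      have hg := RandomHeat.hasGaussianLaw_of_submodule hξ.hasGaussianCharFun
        (fun i => (hξ.memLp_randomConv hm hm0 (htε hε i) ((p i).2 / √ε)))
        (fun i => hξ.toLp_randomConv_mem hm hm0 (htε hε i) _)
      refine (hg.map_fun (ε ^ (-κ 0 / 4) • ContinuousLinearMap.id ℝ (Fin k → ℝ))).congr ?_
      filter_upwards [eventually_all.2 (hae hε)] with ω hω
      funext i
      rw [hω i]
      rfl
    · filter_upwards [self_mem_nhdsWithin] with ε hε i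
      exact hmean hε i
    · exact RandomHeat.hasGaussianLaw_pi (hU2.comp_right p)
    · rw [hU4]
      refine (hξ.tendsto_covariance hm hm0 hw0 hw hκ (p i).1.2 (p j).1.2 (p i).2 (p j).2).congr' ?_
      filter_upwards [self_mem_nhdsWithin] with ε hε
      have hε' : 0 < ε := hε
      rw [covariance, hmean hε i, hmean hε j, ← integral_const_mul]
      refine integral_congr_ae ?_
      filter_upwards [hae hε i, hae hε j] with ω e1 e2
      have e3 : ε ^ (-κ 0 / 2) = ε ^ (-κ 0 / 4) * ε ^ (-κ 0 / 4) := by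
        rw [← Real.rpow_add hε']
        ring_nf
      rw [e1, e2, e3]
      ring
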